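/- Let $k\ge 0$ and $d>1$ be integers. Let $V=T^k\times\mathbb S^{2d+k-1}$ be the submanifold $$V=\Bigl\{(e^{2\pi i\theta_1},\dots,e^{2\pi i\theta_k},z,w)\in T^k\times\mathbb C^d\times\mathbb R^k \;:\; \sum_{j=1}^d|z_j|^2+\sum_{l=1}^k w_l^2=1\Bigr\}$$ with the $1$-form $\beta_k=\sum_{l=1}^k w_l\,d\theta_l+\alpha_{st}$, where $\alpha_{st}=\frac i4\sum_{j=1}^d(z_j\,d\bar z_j-\bar z_j\,dz_j)$, and with the action of $T^{k+d}=T^k\times T^d$ given by $(s,t)*(u,z,w)=(su,tz,w)$. Then $(V,\ker\beta_k)$ is a contact toric manifold with invariant contact form $\beta_k$ (that is, $\beta_k$ is a contact form, and the action is smooth, effective and preserves $\beta_k$). For $k\ge1$ it is not of Reeb type: no invariant contact form for the same co-oriented contact structure has a Reeb vector field generated by an element of the Lie algebra of $T^{k+d}$. Call a subset $L$ of a contact toric manifold a pre-Lagrangian toric fiber if it is an orbit of the torus and a submanifold that is the diffeomorphic image, under the projection from the symplectization, of a Lagrangian submanifold of the symplectization. Call $L$ displaceable if $\varphi_1(L)\cap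 L=\emptyset$ for some smooth contact isotopy $(\varphi_t)_{t\in[0,1]}$ with $\varphi_0=\mathrm{id}$. Then $V$ contains displaceable pre-Lagrangian toric fibers. More precisely, the standard toric contact sphere $(\mathbb S^{2d-1},\alpha_{st})$, with $T^d$ acting by coordinatewise multiplication, is a contact toric manifold, and it is the contact reduction of $(V,\beta_k)$ by the first factor $T^k$ of the torus: zero is a regular value of the moment map $w$ of $T^k$, the torus $T^k$ acts freely on $\{w=0\}$, and $\rho:\{w=0\}\to\mathbb S^{2d-1}$, $\rho(u,z,0)=z$, is a surjective submersion whose fibers are the $T^k$-orbits, with $\rho^*\alpha_{st}=\beta_k$ on $\{w=0\}$; moreover $\rho((s,t)*(u,z,0))=tz$. For all $c_1,\dots,c_d>0$ with $\sum_j c_j^2=1$, the set $L_c=\{z\in\mathbb S^{2d-1}: |z_j|=c_j \text{ for all } j\}$ is a displaceable pre-Lagrangian toric fiber of $\mathbb S^{2d-1}$, and its lift $$\widetilde L_c=\rho^{-1}(L_c)=\{(u,z,w)\in V: w=0,\ |z_j|=c_j \text{ for all } j\},$$ which is also the fiber of the moment map $(w,\pi|z_1|^2,\dots,\pi|z_d|^2)$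 of $\beta_k$ over $(0,\pi c_1^2,\dots,\pi c_d^2)$, is a displaceable pre-Lagrangian toric fiber of $V$. -/

import Mathlib

open scoped ContDiff ComplexConjugate

noncomputable section

namespace ToricContact

/-! ### Embedded submanifolds of Euclidean space -/

section Submanifolds

variable {E F : Type*} [NormedAddCommGroup E] [NormedSpace ℝ E]
  [NormedAddCommGroup F] [NormedSpace ℝ F]

/-- `X` is an embedded smooth submanifold (without boundary) of dimension `n` of the
finite-dimensional space `E`: locally it is the zero set of a smooth submersion to `ℝ^m`,
`n + m = dim E`. -/
def IsSubmanifold (n : ℕ) (X : Set E) : Prop :=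
  ∃ m : ℕ, n + m = Module.finrank ℝ E ∧
    ∀ p ∈ X, ∃ U : Set E, IsOpen U ∧ p ∈ U ∧ ∃ g : E → (Fin m → ℝ),
      ContDiffOn ℝ ∞ g U ∧ (∀ q ∈ U, Function.Surjective (fderiv ℝ g q)) ∧
      X ∩ U = {q ∈ U | g q = 0}

/-- The tangent space of `X` at `p`. (For a submanifold the tangent cone is already a linear
subspace.) -/
def tangentSpace (X : Set E) (p : E) : Submodule ℝ E :=
  Submodule.span ℝ (tangentConeAt ℝ X p)

/-- `f` restricts to a diffeomorphism from `X` onto `Y`. -/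
def IsDiffeo (X : Set E) (Y : Set F) (f : E → F) : Prop :=
  ContDiffOn ℝ ∞ f X ∧ Set.MapsTo f X Y ∧
    ∃ g : F → E, ContDiffOn ℝ ∞ g Y ∧ Set.MapsTo g Y X ∧ Set.InvOn g f X Y

/-- The exterior derivative of a `1`-form on `E`, evaluated at `p` on the vectors `v, w`. On
vectors tangent to a submanifold it is the exterior derivative of the restricted form. -/
def dForm (α : E → E →L[ℝ] ℝ) (p v w : E) : ℝ :=
  extDeriv (fun q => ContinuousAlternatingMap.ofSubsingleton ℝ E ℝ (0 : Fin 1) (α q)) p ![v, w]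

end Submanifolds

/-! ### Contact forms, contact isotopies, symplectization

Smooth `1`-forms on a submanifold `V ⊆ E` are given by smooth ambient `1`-forms; only their values
on tangent vectors of `V` matter. -/

section Contact

variable {E : Type*} [NormedAddCommGroup E] [NormedSpace ℝ E]

/-- `α` restricts to a contact form on `V`: `α` does not vanish on any tangent space of `V`, and
`dα` is nondegenerate on the hyperplane `ξ_p = ker α_p ∩ T_p V`. -/
def IsContactForm (V : Set E) (α : E → E →L[ℝ] ℝ) : Prop :=
  ContDiff ℝ ∞ α ∧ ∀ p ∈ V,
    (∃ v ∈ tangentSpace V p, α p v ≠ 0) ∧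
    ∀ v ∈ tangentSpace V p, α p v = 0 →
      (∀ w ∈ tangentSpace V p, α p w = 0 → dForm α p v w = 0) → v = 0

/-- `f` restricts to a diffeomorphism of `V` whose derivative preserves `ξ = ker α`. -/
def IsContactomorphism (V : Set E) (α : E → E →L[ℝ] ℝ) (f : E → E) : Prop :=
  IsDiffeo V V f ∧ ∀ p ∈ V, ∀ v ∈ tangentSpace V p,
    (α p v = 0 ↔ α (f p) (fderivWithin ℝ f V p v) = 0)

/-- A smooth contact isotopy `φ_t`, `t ∈ [0,1]`, of `(V, ker α)` starting at the identity. -/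
def IsContactIsotopy (V : Set E) (α : E → E →L[ℝ] ℝ) (φ : ℝ → E → E) : Prop :=
  ContDiffOn ℝ ∞ (fun x : ℝ × E => φ x.1 x.2) (Set.Icc 0 1 ×ˢ V) ∧
    (∀ p ∈ V, φ 0 p = p) ∧
    ∀ t ∈ Set.Icc (0 : ℝ) 1, IsContactomorphism V α (φ t)

/-- `L` is displaced from itself by the time-one map of some contact isotopy. -/
def IsDisplaceable (V : Set E) (α : E → E →L[ℝ] ℝ) (L : Set E) : Prop :=
  ∃ φ : ℝ → E → E, IsContactIsotopy V α φ ∧ φ 1 '' L ∩ L = ∅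

/-- The symplectization `SV`, trivialized by the contact form `α`: the point `(p, s)`, `s > 0`,
stands for the covector `s • α_p`, whose kernel is `ξ_p`. -/
def symplectization (V : Set E) : Set (E × ℝ) := V ×ˢ Set.Ioi 0

/-- The Liouville form of the symplectization: at the covector `s • α_p` it is the pull-back of
this covector under the projection to `V`. -/
def liouvilleForm (α : E → E →L[ℝ] ℝ) : E × ℝ → (E × ℝ →L[ℝ] ℝ) :=
  fun x => x.2 • (α x.1).comp (ContinuousLinearMap.fst ℝ E ℝ)

/-- `Λ` is a Lagrangian submanifold of the symplectization `(SV, dλ)`. -/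
def IsLagrangian (V : Set E) (α : E → E →L[ℝ] ℝ) (Λ : Set (E × ℝ)) : Prop :=
  Λ ⊆ symplectization V ∧
    (∃ n : ℕ, IsSubmanifold (2 * n) (symplectization V) ∧ IsSubmanifold n Λ) ∧
    ∀ x ∈ Λ, ∀ v ∈ tangentSpace Λ x, ∀ w ∈ tangentSpace Λ x, dForm (liouvilleForm α) x v w = 0

/-- `L ⊆ V` is pre-Lagrangian: a submanifold that is the diffeomorphic image, under the projection
`SV → V`, of a Lagrangian submanifold of the symplectization. -/
def IsPreLagrangian (V : Set E) (α : E → E →L[ℝ] ℝ) (L : Set E) : Prop :=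
  L ⊆ V ∧ (∃ n : ℕ, IsSubmanifold n L) ∧
    ∃ Λ : Set (E × ℝ), IsLagrangian V α Λ ∧ IsDiffeo Λ L Prod.fst

end Contact

/-! ### Torus actions -/

section Toric

variable {E E' : Type*} [NormedAddCommGroup E] [NormedSpace ℝ E]
  [NormedAddCommGroup E'] [NormedSpace ℝ E']
  {ι κ : Type*} [Fintype ι] [Fintype κ]

/-- The torus `T^ι`, with pointwise multiplication. -/
def torus (ι : Type*) : Set (ι → ℂ) := {s | ∀ i, ‖s i‖ = 1}

/-- The exponential map `ℝ^ι → T^ι` of the torus, with the convention `S¹ = ℝ/ℤ`. -/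
def torusExp (X : ι → ℝ) : ι → ℂ := fun i => Complex.exp (2 * Real.pi * Complex.I * (X i : ℂ))

/-- The vector field generated by the element `X` of the Lie algebra `ℝ^ι` of the torus. -/
def fundamentalField (A : (ι → ℂ) → E → E) (X : ι → ℝ) (p : E) : E :=
  deriv (fun t : ℝ => A (torusExp (t • X)) p) 0

/-- The `α`-moment map, `⟨μ_α(p), X⟩ = α_p(X_p)`, in the coordinates of `(ℝ^ι)^*`. -/
def momentMap [DecidableEq ι] (α : E → E →L[ℝ] ℝ) (A : (ι → ℂ) → E → E) (p : E) : ι → ℝ :=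
  fun i => α p (fundamentalField A (Pi.single i 1) p)

/-- `A` is a smooth action of the torus `T^ι` on `V` that preserves the form `α` on `V`. -/
structure IsInvariantTorusAction (V : Set E) (α : E → E →L[ℝ] ℝ) (A : (ι → ℂ) → E → E) :
    Prop where
  mapsTo : ∀ s ∈ torus ι, Set.MapsTo (A s) V V
  one : ∀ p ∈ V, A 1 p = p
  mul : ∀ s ∈ torus ι, ∀ t ∈ torus ι, ∀ p ∈ V, A (s * t) p = A s (A t p)
  smooth : ContDiffOn ℝ ∞ (fun x : (ι → ℂ) × E => A x.1 x.2) (torus ι ×ˢ V)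
  invariant : ∀ s ∈ torus ι, ∀ p ∈ V, ∀ v ∈ tangentSpace V p,
    α (A s p) (fderivWithin ℝ (A s) V p v) = α p v

/-- `V`, with the contact structure `ker α` and the torus action `A`, is a contact toric manifold,
and `α` is an invariant contact form on it: `dim V = 2 dim T^ι - 1`, and the action is effective. -/
structure IsToricContact (V : Set E) (α : E → E →L[ℝ] ℝ) (A : (ι → ℂ) → E → E) : Prop where
  submanifold : ∃ n : ℕ, n + 1 = 2 * Fintype.card ι ∧ IsSubmanifold n V
  contact : IsContactForm V α
  action : IsInvariantTorusAction V α A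
  effective : ∀ s ∈ torus ι, (∀ p ∈ V, A s p = p) → s = 1

/-- The contact toric manifold is of Reeb type: some invariant contact form `α'` for the same
co-oriented contact structure has a Reeb vector field that is generated by an element of the Lie
algebra of the torus. -/
def IsReebType (V : Set E) (α : E → E →L[ℝ] ℝ) (A : (ι → ℂ) → E → E) : Prop :=
  ∃ α' : E → E →L[ℝ] ℝ, IsToricContact V α' A ∧
    (∀ p ∈ V, ∃ r : ℝ, 0 < r ∧ ∀ v ∈ tangentSpace V p, α' p v = r * α p v) ∧
    ∃ X : ι → ℝ, ∀ p ∈ V, α' p (fundamentalField A X p) = 1 ∧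
      ∀ v ∈ tangentSpace V p, dForm α' p (fundamentalField A X p) v = 0

/-- A pre-Lagrangian toric fiber: an orbit of the torus action that is a pre-Lagrangian
submanifold. -/
def IsPreLagrangianToricFiber (V : Set E) (α : E → E →L[ℝ] ℝ) (A : (ι → ℂ) → E → E)
    (L : Set E) : Prop :=
  (∃ p ∈ V, L = (fun s => A s p) '' torus ι) ∧ IsPreLagrangian V α L

/-- The zero level of the moment map of a torus action. -/
def zeroLevel [DecidableEq κ] (V : Set E) (α : E → E →L[ℝ] ℝ) (G : (κ → ℂ) → E → E) : Set E :=
  {p ∈ V | momentMap α G p = 0}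

/-- `(V', α')` is the contact reduction of `(V, α)` with respect to the torus action `G`, with
quotient map `ρ`: zero is a regular value of the moment map `μ_G`, the torus acts freely on
`μ_G⁻¹(0)`, the map `ρ : μ_G⁻¹(0) → V'` is a surjective submersion whose fibers are the orbits of
`G`, and `ρ^* α' = α` on `μ_G⁻¹(0)`. -/
structure IsContactReduction [DecidableEq κ] (V : Set E) (α : E → E →L[ℝ] ℝ)
    (G : (κ → ℂ) → E → E) (V' : Set E') (α' : E' → E' →L[ℝ] ℝ) (ρ : E → E') : Prop where
  action : IsInvariantTorusAction V α G
  regular : ∀ p ∈ zeroLevel V α G, ∀ y : κ → ℝ,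
    ∃ v ∈ tangentSpace V p, fderivWithin ℝ (momentMap α G) V p v = y
  free : ∀ p ∈ zeroLevel V α G, ∀ s ∈ torus κ, G s p = p → s = 1
  mapsTo : Set.MapsTo ρ (zeroLevel V α G) V'
  surjOn : Set.SurjOn ρ (zeroLevel V α G) V'
  smooth : ContDiffOn ℝ ∞ ρ (zeroLevel V α G)
  fibers : ∀ p ∈ zeroLevel V α G, ∀ q ∈ zeroLevel V α G,
    ρ p = ρ q ↔ ∃ s ∈ torus κ, G s p = q
  submersion : ∀ p ∈ zeroLevel V α G, ∀ y ∈ tangentSpace V' (ρ p),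
    ∃ v ∈ tangentSpace (zeroLevel V α G) p, fderivWithin ℝ ρ (zeroLevel V α G) p v = y
  pullback : ∀ p ∈ zeroLevel V α G, ∀ v ∈ tangentSpace (zeroLevel V α G) p,
    α' (ρ p) (fderivWithin ℝ ρ (zeroLevel V α G) p v) = α p v

end Toric

/-! ### The standard contact sphere and the manifolds `T^k × S^{2d+k-1}` -/

/-- The real covector `v ↦ Im (conj u * v) = x dy - y dx` at `u = x + i y`. -/
def angularForm (u : ℂ) : ℂ →L[ℝ] ℝ :=
  Complex.imCLM.comp (ContinuousLinearMap.mul ℝ ℂ (conj u))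

/-- The unit sphere `S^{2d-1} ⊆ ℂ^d`. -/
def stdSphere (d : ℕ) : Set (Fin d → ℂ) := {z | ∑ j, ‖z j‖ ^ 2 = 1}

/-- `α_st = (i/4) ∑ (z_j d conj z_j - conj z_j dz_j) = (1/2) ∑ (x_j dy_j - y_j dx_j)`. -/
def stdForm (d : ℕ) (z : Fin d → ℂ) : (Fin d → ℂ) →L[ℝ] ℝ :=
  ∑ j, (1 / 2 : ℝ) • (angularForm (z j)).comp (ContinuousLinearMap.proj j)

/-- The standard action of `T^d` on `S^{2d-1}`. -/
def stdAction (d : ℕ) (t : Fin d → ℂ) (z : Fin d → ℂ) : Fin d → ℂ := t * z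

/-- `{z ∈ S^{2d-1} : |z_j| = c_j}`. -/
def stdFiber (d : ℕ) (c : Fin d → ℝ) : Set (Fin d → ℂ) := {z ∈ stdSphere d | ∀ j, ‖z j‖ = c j}

/-- The space `ℂ^k × ℂ^d × ℝ^k` of triples `(u, z, w)` containing `T^k × S^{2d+k-1}`. -/
abbrev Ambient (k d : ℕ) : Type := (Fin k → ℂ) × (Fin d → ℂ) × (Fin k → ℝ)

/-- `T^k × S^{2d+k-1} = {(u, z, w) : |u_l| = 1, ∑ |z_j|² + ∑ w_l² = 1}`. -/
def torusSphere (k d : ℕ) : Set (Ambient k d) :=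
  {p | p.1 ∈ torus (Fin k) ∧ ∑ j, ‖p.2.1 j‖ ^ 2 + ∑ l, p.2.2 l ^ 2 = 1}

/-- The contact form `β_k = ∑ w_l dθ_l + (i/4) ∑ (z_j d conj z_j - conj z_j dz_j)`, where
`u_l = exp (2πiθ_l)`, so that `dθ_l` is `1/(2π)` times the angular form. -/
def betaForm (k d : ℕ) (p : Ambient k d) : Ambient k d →L[ℝ] ℝ :=
  ∑ l, (p.2.2 l / (2 * Real.pi)) • (angularForm (p.1 l)).comp
      ((ContinuousLinearMap.proj l).comp (ContinuousLinearMap.fst ℝ _ _)) +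
    (stdForm d p.2.1).comp
      ((ContinuousLinearMap.fst ℝ _ _).comp (ContinuousLinearMap.snd ℝ _ _))

/-- The action of `T^{k+d}`: `(s, t) * (u, z, w) = (s u, t z, w)`. -/
def toricAction (k d : ℕ) (s : Fin k ⊕ Fin d → ℂ) (p : Ambient k d) : Ambient k d :=
  (fun l => s (Sum.inl l) * p.1 l, fun j => s (Sum.inr j) * p.2.1 j, p.2.2)

/-- The action of the first `k` circles of `T^{k+d}`. -/
def firstAction (k d : ℕ) (s : Fin k → ℂ) : Ambient k d → Ambient k d :=
  toricAction k d (Sum.elim s 1)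

/-- The reduction map `(u, z, 0) ↦ z`. -/
def reductionMap (k d : ℕ) (p : Ambient k d) : Fin d → ℂ := p.2.1

/-- `{(u, z, a) ∈ T^k × S^{2d+k-1} : |z_j| = c_j}`. -/
def toricFiber (k d : ℕ) (c : Fin d → ℝ) (a : Fin k → ℝ) : Set (Ambient k d) :=
  {p ∈ torusSphere k d | p.2.2 = a ∧ ∀ j, ‖p.2.1 j‖ = c j}

end ToricContact

end

open ToricContact

namespace ToricContact

/-! ### Tangent spaces, local zero sets and exterior derivatives in a normed space. -/

section General

variable {E F : Type*} [NormedAddCommGroup E] [NormedSpace ℝ E]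
  [NormedAddCommGroup F] [NormedSpace ℝ F]

/-! The contact, reduction and moment map statements are explicit computations. The failure of Reeb
type is a sign obstruction: at `z = 0`, `w = ±e_l` the form `β_k` takes opposite values on the same
generator `X`, so no positive multiple of `β_k` can equal one on `X` at both points
(`not_isReebType`). The fibers are pre-Lagrangian because `dβ_k` vanishes on the torus orbits over
`w = 0`, so that the slice `s = 1` of the symplectization over them is Lagrangian
(`isPreLagrangian_of_isotropic`).

Displacement on the sphere comes from `U(d,1)`, which acts on `S^{2d-1}` as the boundary of the
complex ball. Lift `z` to the null vector `(z, ‖z‖)` of `ℂ^{d,1}`, multiply the component along a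
negative vector `(b e_j, a)`, `a² - b² = 1`, by a unit number `e`, and restore a positive last
coordinate by a phase. This is `reflect`: a rotation of the ball about the interior point `(b/a)
e_j`. It respects the contact structure because complex reflections preserve the Hermitian form
(`reflect_hermitian_identity`). For `e = -1` and a center far enough from the origin it displaces
the torus `|z_j| = c_j`: the remaining coordinates change only by a phase and a scale, so a point
returning to the torus would have a last coordinate of modulus one, while its real part is below
`-1` (`exists_rotationData`, `isDisplaceable_toricFiber`).

On `T^k × S^{2d+k-1}` the symplectization is an open part of `T^*T^k × ℂ^d`, with weighted dilations
`(u, tz, t²w)`. Up to constants, the rotation has Hamiltonian `H = |q|²`, where `q = a‖z‖ - b z_j`.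
It is not smooth at `z = 0`, so it is replaced by `H χ(|w|²/H²)`, still homogeneous, with `χ`
vanishing on `[1, ∞)`. Since `H` and the `w_l` commute, the new flow is explicit: it rotates by an
angle and translates the `θ_l`, both depending only on the conserved quotient `w/H`. The identity
`exists_hasDerivAt_shift_angle` says that the two contributions to the pull-back of `β_k` cancel,
and `betaForm_fderiv_contactFlow` concludes. On `w = 0` the cut-off is inactive, so the lifted fiber
moves as the torus in the sphere does.

The pre-Lagrangian and displacement statements for the sphere itself are the case `k = 0`,
transported along a linear isomorphism. -/

theorem dForm_eq {α : E → E →L[ℝ] ℝ} {p : E} (h : DifferentiableAt ℝ α p) (v w : E) :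
    dForm α p v w = fderiv ℝ α p v w - fderiv ℝ α p w v := by
  let L : (E →L[ℝ] ℝ) ≃ₗᵢ[ℝ] (E [⋀^Fin 1]→L[ℝ] ℝ) :=
    ContinuousAlternatingMap.ofSubsingletonLIE (0 : Fin 1)
  have h1 : HasFDerivAt
      (fun q => ContinuousAlternatingMap.ofSubsingleton ℝ E ℝ (0 : Fin 1) (α q))
      (L.toContinuousLinearEquiv.toContinuousLinearMap.comp (fderiv ℝ α p)) p :=
    L.toContinuousLinearEquiv.hasFDerivAt.comp p h.hasFDerivAt
  have h2 (u w : E) : fderiv ℝ (fun x => α x u) p w = fderiv ℝ α p w u := by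
    rw [(h.hasFDerivAt.clm_apply (hasFDerivAt_const u p)).fderiv]
    simp
  rw [dForm, extDeriv_apply h1.differentiableAt]
  simp [Fin.sum_univ_two, sub_eq_add_neg, Fin.removeNth, h2]

/-- Derivatives within `X` need not be unique on the whole ambient space, but any two agree on the
tangent cone, hence by linearity on its span. Any convenient ambient derivative may therefore be
used on tangent vectors. -/
theorem fderivWithin_of_mem_tangentSpace {f : E → F} {f' : E →L[ℝ] F} {X : Set E} {p v : E}
    (h : HasFDerivWithinAt f f' X p) (hv : v ∈ tangentSpace X p) :
    fderivWithin ℝ f X p v = f' v := by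
  have h2 : HasFDerivWithinAt f (fderivWithin ℝ f X p) X p :=
    h.differentiableWithinAt.hasFDerivWithinAt
  have h3 := h2.unique_on h
  induction hv using Submodule.span_induction with
  | mem x hx => exact h3 hx
  | zero => simp
  | add x y _ _ hx hy => simp [hx, hy]
  | smul a x _ hx => simp [hx]

theorem mem_tangentSpace_of_mapsTo {f : E → F} {f' : E →L[ℝ] F} {X : Set E} {Y : Set F} {p v : E}
    (h : HasFDerivWithinAt f f' X p) (hf : Set.MapsTo f X Y) (hv : v ∈ tangentSpace X p) :
    f' v ∈ tangentSpace Y (f p) := by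
  induction hv using Submodule.span_induction with
  | mem x hx =>
    exact Submodule.subset_span (tangentConeAt_mono hf.image_subset (h.mapsTo_tangent_cone hx))
  | zero => simp
  | add x y _ _ hx hy => simpa using Submodule.add_mem _ hx hy
  | smul a x _ hx => simpa using Submodule.smul_mem _ a hx

theorem mem_tangentSpace_of_curve {X : Set E} {γ : ℝ → E} {v : E} (h : HasDerivAt γ v 0)
    (hX : ∀ t, γ t ∈ X) : v ∈ tangentSpace X (γ 0) := by
  have h1 : (1 : ℝ) ∈ tangentSpace (Set.univ : Set ℝ) 0 := by
    apply Submodule.subset_span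
    rw [tangentConeAt_univ]; trivial
  simpa using mem_tangentSpace_of_mapsTo (Y := X) h.hasFDerivAt.hasFDerivWithinAt
    (fun t _ => hX t) h1

theorem apply_eq_zero_of_mem_tangentSpace {g : E → F} {g' : E →L[ℝ] F} {X : Set E} {p v : E}
    (h : HasFDerivAt g g' p) (hX : ∀ q ∈ X, g q = g p) (hv : v ∈ tangentSpace X p) :
    g' v = 0 := by
  rw [← fderivWithin_of_mem_tangentSpace h.hasFDerivWithinAt hv,
    fderivWithin_of_mem_tangentSpace (f' := 0) _ hv]
  · simp
  · exact (hasFDerivWithinAt_const (g p) p X).congr hX rfl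

/-- The implicit function theorem parametrizes the level set of `g` by the kernel of `g'`, and the
derivative of this parametrization at the origin is the inclusion of the kernel. -/
theorem mem_tangentSpace_of_apply_eq_zero [CompleteSpace E] [FiniteDimensional ℝ F]
    {g : E → F} {g' : E →L[ℝ] F} {X : Set E} {p v : E}
    (h : HasStrictFDerivAt g g' p) (hs : Function.Surjective g')
    (hX : ∀ᶠ q in nhds p, g q = g p → q ∈ X) (hv : g' v = 0) : v ∈ tangentSpace X p := by
  have hr : g'.range = ⊤ := LinearMap.range_eq_top.mpr hs
  set Φ := h.implicitFunction g g' hr (g p) with hΦ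
  have h0 : Φ 0 = p := h.implicitFunction_apply_image hr
  have hd : HasStrictFDerivAt Φ g'.ker.subtypeL 0 := h.to_implicitFunction hr
  have hc : Filter.Tendsto Φ (nhds 0) (nhds p) := by
    simpa [h0] using hd.hasFDerivAt.continuousAt.tendsto
  have he : ∀ᶠ y in nhds (0 : g'.ker), Φ y ∈ X := by
    have h1 := (h.map_implicitFunction_eq hr)
    rw [nhds_prod_eq] at h1
    have h2 : ∀ᶠ y in nhds (0 : g'.ker), g (Φ y) = g p := h1.curry.self_of_nhds
    filter_upwards [h2, hc.eventually hX] with y hy1 hy2 using hy2 hy1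
  have h3 : (⟨v, hv⟩ : g'.ker) ∈ tangentSpace {y | Φ y ∈ X} 0 := by
    apply Submodule.subset_span
    rw [tangentConeAt_of_mem_nhds he]; trivial
  have := mem_tangentSpace_of_mapsTo (Y := X) hd.hasFDerivAt.hasFDerivWithinAt
    (fun y hy => hy) h3
  rw [h0] at this
  exact this

/-- An arbitrary finite index type lets the defining equations be indexed by sum types, one summand
for each family of equations. -/
theorem isSubmanifold_of_local_zeroSet {ι : Type*} [Fintype ι] {n : ℕ} {X : Set E}
    (hn : n + Fintype.card ι = Module.finrank ℝ E)
    (h : ∀ p ∈ X, ∃ U : Set E, IsOpen U ∧ p ∈ U ∧ ∃ g : E → (ι → ℝ),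
      ContDiffOn ℝ ∞ g U ∧ (∀ q ∈ U, Function.Surjective (fderiv ℝ g q)) ∧
      ∀ q ∈ U, q ∈ X ↔ g q = 0) : IsSubmanifold n X := by
  refine ⟨Fintype.card ι, hn, fun p hp => ?_⟩
  obtain ⟨U, hU, hpU, g, hg, hs, hX⟩ := h p hp
  refine ⟨U, hU, hpU, ?_⟩
  set e : (ι → ℝ) ≃L[ℝ] (Fin (Fintype.card ι) → ℝ) :=
    (LinearEquiv.funCongrLeft ℝ ℝ (Fintype.equivFin ι).symm).toContinuousLinearEquiv
  refine ⟨fun x => e (g x), e.contDiff.comp_contDiffOn hg, fun q hq => ?_, ?_⟩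
  · have hd : DifferentiableAt ℝ g q :=
      (hg.contDiffAt (hU.mem_nhds hq)).differentiableAt (by simp)
    have : fderiv ℝ (fun x => e (g x)) q = (e : (ι → ℝ) →L[ℝ] _).comp (fderiv ℝ g q) :=
      (e.hasFDerivAt.comp q hd.hasFDerivAt).fderiv
    rw [this]
    exact e.surjective.comp (hs q hq)
  · ext q
    constructor
    · rintro ⟨h1, h2⟩
      exact ⟨h2, by simp [(hX q h2).1 h1]⟩
    · rintro ⟨h1, h2⟩
      refine ⟨(hX q h1).2 ?_, h1⟩
      simpa using h2

/-- Once differentiability is known, a derivative can be computed along lines, one coordinate at a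
time. -/
theorem fderiv_apply_eq_of_hasDerivAt {f : E → F} {p v : E} {d : F} (hf : DifferentiableAt ℝ f p)
    (h : HasDerivAt (fun t : ℝ => f (p + t • v)) d 0) : fderiv ℝ f p v = d := by
  have h1 : HasDerivAt (fun t : ℝ => p + t • v) v 0 := by
    simpa using ((hasDerivAt_id (0 : ℝ)).smul_const v).const_add p
  have h2 : HasFDerivAt f (fderiv ℝ f p) (p + (0 : ℝ) • v) := by simpa using hf.hasFDerivAt
  exact (h2.comp_hasDerivAt (0 : ℝ) h1).unique h

theorem fderiv_form_apply_eq_of_hasDerivAt {α : E → E →L[ℝ] ℝ} {p v w : E} {d : ℝ}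
    (hα : DifferentiableAt ℝ α p) (h : HasDerivAt (fun t : ℝ => α (p + t • v) w) d 0) :
    fderiv ℝ α p v w = d := by
  have h1 := hα.hasFDerivAt.clm_apply (hasFDerivAt_const w p)
  have := fderiv_apply_eq_of_hasDerivAt (f := fun q => α q w) h1.differentiableAt h
  rw [h1.fderiv] at this
  simpa using this

theorem IsSubmanifold.prod_singleton [FiniteDimensional ℝ E] {n : ℕ} {X : Set E}
    (h : IsSubmanifold n X) : IsSubmanifold n (X ×ˢ ({1} : Set ℝ)) := by
  obtain ⟨m, hm, h⟩ := h
  refine isSubmanifold_of_local_zeroSet (ι := Fin m ⊕ Unit) (by simp; omega) ?_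
  rintro ⟨p, s⟩ ⟨hp, -⟩
  obtain ⟨U, hU, hpU, g, hg, hs, hX⟩ := h p hp
  have hd (q) (hq : q ∈ U) : DifferentiableAt ℝ g q :=
      (hg.contDiffAt (hU.mem_nhds hq)).differentiableAt (by simp)
  refine ⟨U ×ˢ Set.univ, hU.prod isOpen_univ, ⟨hpU, trivial⟩,
    fun x => Sum.elim (g x.1) (fun _ => x.2 - 1), ?_, ?_, ?_⟩
  · rw [contDiffOn_pi]
    rintro (i | i)
    · exact (contDiffOn_pi.1 hg i).comp contDiff_fst.contDiffOn fun x hx => hx.1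
    · exact (contDiff_snd.sub contDiff_const).contDiffOn
  · rintro ⟨q, r⟩ ⟨hq, -⟩ y
    obtain ⟨v, hv⟩ := hs q hq (fun i => y (Sum.inl i))
    refine ⟨(v, y (Sum.inr ())), ?_⟩
    have : HasFDerivAt (fun x : E × ℝ => (Sum.elim (g x.1) (fun _ => x.2 - 1) : Fin m ⊕ Unit → ℝ))
        (ContinuousLinearMap.pi (Sum.elim
          (fun i => ((ContinuousLinearMap.proj i).comp (fderiv ℝ g q)).comp
            (ContinuousLinearMap.fst ℝ E ℝ))
          (fun _ => ContinuousLinearMap.snd ℝ E ℝ))) (q, r) := by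
      rw [hasFDerivAt_pi]
      have hf : HasFDerivAt Prod.fst (ContinuousLinearMap.fst ℝ E ℝ) (q, r) := hasFDerivAt_fst
      rintro (i | i)
      · exact HasFDerivAt.comp (q, r) (f := Prod.fst) (g := fun x => g x i)
          (hasFDerivAt_pi'.1 (hd q hq).hasFDerivAt i) hf
      · exact hasFDerivAt_snd.sub_const 1
    rw [this.fderiv]
    ext (i | i)
    · simp [hv]
    · simp
  · rintro ⟨q, r⟩ ⟨hq, -⟩
    have h1 : q ∈ X ↔ g q = 0 :=
      ⟨fun h => (hX.subset ⟨h, hq⟩).2, fun h => (hX.superset ⟨hq, h⟩).1⟩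
    simp only [Set.mem_prod, h1, Set.mem_singleton_iff, funext_iff, Sum.forall, Sum.elim_inl,
      Sum.elim_inr, Pi.zero_apply, sub_eq_zero, forall_const]

theorem IsSubmanifold.prod_Ioi [FiniteDimensional ℝ E] {n : ℕ} {X : Set E}
    (h : IsSubmanifold n X) : IsSubmanifold (n + 1) (X ×ˢ Set.Ioi (0 : ℝ)) := by
  obtain ⟨m, hm, h⟩ := h
  refine isSubmanifold_of_local_zeroSet (ι := Fin m) (by simp; omega) ?_
  rintro ⟨p, s⟩ ⟨hp, hs0⟩
  obtain ⟨U, hU, hpU, g, hg, hs, hX⟩ := h p hp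
  refine ⟨U ×ˢ Set.Ioi 0, hU.prod isOpen_Ioi, ⟨hpU, hs0⟩, fun x => g x.1, ?_, ?_, ?_⟩
  · exact hg.comp contDiff_fst.contDiffOn fun x hx => hx.1
  · rintro ⟨q, r⟩ ⟨hq, -⟩ y
    obtain ⟨v, hv⟩ := hs q hq y
    have hd : DifferentiableAt ℝ g q :=
      (hg.contDiffAt (hU.mem_nhds hq)).differentiableAt (by simp)
    have hf : HasFDerivAt Prod.fst (ContinuousLinearMap.fst ℝ E ℝ) (q, r) := hasFDerivAt_fst
    have h2 : HasFDerivAt (fun x : E × ℝ => g x.1) _ (q, r) :=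
      HasFDerivAt.comp (q, r) (f := Prod.fst) (g := g) hd.hasFDerivAt hf
    exact ⟨(v, 0), by rw [h2.fderiv]; simpa using hv⟩
  · rintro ⟨q, r⟩ ⟨hq, hr⟩
    have h1 : q ∈ X ↔ g q = 0 :=
      ⟨fun h => (hX.subset ⟨h, hq⟩).2, fun h => (hX.superset ⟨hq, h⟩).1⟩
    simp only [Set.mem_prod, h1, hr, and_true]

theorem dForm_liouvilleForm {α : E → E →L[ℝ] ℝ} {p : E} (h : DifferentiableAt ℝ α p) (s : ℝ)
    (v w : E) : dForm (liouvilleForm α) (p, s) (v, 0) (w, 0) = s * dForm α p v w := by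
  let R : (E →L[ℝ] ℝ) →L[ℝ] (E × ℝ →L[ℝ] ℝ) :=
    (ContinuousLinearMap.compL ℝ (E × ℝ) E ℝ).flip (ContinuousLinearMap.fst ℝ E ℝ)
  have hf : HasFDerivAt Prod.fst (ContinuousLinearMap.fst ℝ E ℝ) (p, s) := hasFDerivAt_fst
  have h1 : HasFDerivAt (fun x : E × ℝ => (α x.1).comp (ContinuousLinearMap.fst ℝ E ℝ))
      (R.comp ((fderiv ℝ α p).comp (ContinuousLinearMap.fst ℝ E ℝ))) (p, s) :=
    HasFDerivAt.comp (p, s) (g := R) R.hasFDerivAt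
      (HasFDerivAt.comp (p, s) (f := Prod.fst) (g := α) h.hasFDerivAt hf)
  have h2 : HasFDerivAt (liouvilleForm α) _ (p, s) :=
    (hasFDerivAt_snd (𝕜 := ℝ) (E := E) (F := ℝ)).smul h1
  rw [dForm_eq h2.differentiableAt, dForm_eq h, h2.fderiv]
  simp [R, mul_sub]

/-- The Lagrangian is the slice `L × {1}`. Its tangent vectors have no component along the
symplectization parameter, and on such vectors the differential of the Liouville form is a multiple
of `dα`. The relation `m + 1 = 2n` supplies the half dimension. -/
theorem isPreLagrangian_of_isotropic [FiniteDimensional ℝ E] {V L : Set E} {α : E → E →L[ℝ] ℝ}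
    {n m : ℕ} (hm : m + 1 = 2 * n) (hα : Differentiable ℝ α) (hLV : L ⊆ V)
    (hV : IsSubmanifold m V) (hL : IsSubmanifold n L)
    (h : ∀ p ∈ L, ∀ v ∈ tangentSpace L p, ∀ w ∈ tangentSpace L p, dForm α p v w = 0) :
    IsPreLagrangian V α L := by
  refine ⟨hLV, ⟨n, hL⟩, L ×ˢ {1}, ⟨?_, ⟨n, hm ▸ hV.prod_Ioi, hL.prod_singleton⟩, ?_⟩, ?_⟩
  · rintro ⟨p, s⟩ ⟨hp, hs⟩
    exact ⟨hLV hp, Set.mem_Ioi.2 (hs.symm ▸ one_pos)⟩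
  · rintro ⟨p, s⟩ ⟨hp, hs⟩ ⟨v, v'⟩ hv ⟨w, w'⟩ hw
    have key (u : E) (u' : ℝ) (hu : (u, u') ∈ tangentSpace (L ×ˢ ({1} : Set ℝ)) (p, s)) :
        u ∈ tangentSpace L p ∧ u' = 0 := by
      refine ⟨mem_tangentSpace_of_mapsTo (Y := L) (hasFDerivWithinAt_fst (𝕜 := ℝ) (p := (p, s)))
        (fun x hx => hx.1) hu, ?_⟩
      refine apply_eq_zero_of_mem_tangentSpace (g' := ContinuousLinearMap.snd ℝ E ℝ)
        hasFDerivAt_snd (fun q hq => ?_) hu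
      exact hq.2.trans hs.symm
    obtain ⟨hv1, rfl⟩ := key v v' hv
    obtain ⟨hw1, rfl⟩ := key w w' hw
    rw [dForm_liouvilleForm (hα p), h p hp v hv1 w hw1, mul_zero]
  · refine ⟨contDiff_fst.contDiffOn, fun x hx => hx.1, fun p => (p, 1),
      (contDiff_id.prodMk contDiff_const).contDiffOn, fun p hp => ⟨hp, rfl⟩, ?_, fun p _ => rfl⟩
    rintro ⟨p, s⟩ ⟨-, hs⟩
    exact Prod.ext rfl (Set.mem_singleton_iff.1 hs).symm

end General

/-! ### The contact form on `T^k × S^{2d+k-1}`. -/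

theorem angularForm_apply (u v : ℂ) : angularForm u v = u.re * v.im - u.im * v.re := by
  simp [angularForm, sub_eq_add_neg]

theorem stdForm_apply (d : ℕ) (z v : Fin d → ℂ) :
    stdForm d z v = ∑ j, 1 / 2 * angularForm (z j) (v j) := by
  simp [stdForm]

theorem betaForm_apply (k d : ℕ) (p v : Ambient k d) :
    betaForm k d p v = ∑ l, p.2.2 l / (2 * Real.pi) * angularForm (p.1 l) (v.1 l) +
      ∑ j, 1 / 2 * angularForm (p.2.1 j) (v.2.1 j) := by
  simp [betaForm, stdForm_apply]

theorem contDiff_angularForm : ContDiff ℝ ∞ angularForm := by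
  unfold angularForm
  have : ContDiff ℝ ∞ (fun u : ℂ => (conj u : ℂ)) := Complex.conjCLE.contDiff
  fun_prop

theorem contDiff_stdForm (d : ℕ) : ContDiff ℝ ∞ (stdForm d) := by
  have := contDiff_angularForm
  unfold stdForm
  fun_prop

theorem contDiff_betaForm (k d : ℕ) : ContDiff ℝ ∞ (betaForm k d) := by
  have := contDiff_angularForm
  have := contDiff_stdForm d
  unfold betaForm
  fun_prop

theorem hasDerivAt_angularForm_line (u v w : ℂ) :
    HasDerivAt (fun t : ℝ => angularForm (u + t • v) w) (angularForm v w) 0 := by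
  have h1 : (fun t : ℝ => angularForm (u + t • v) w) =
      fun t : ℝ => angularForm u w + t * angularForm v w := by
    funext t
    simp [angularForm_apply]
    ring
  rw [h1]
  simpa using ((hasDerivAt_id (0 : ℝ)).mul_const (angularForm v w)).const_add (angularForm u w)

theorem hasDerivAt_norm_sq_line (u v : ℂ) :
    HasDerivAt (fun t : ℝ => ‖u + t • v‖ ^ 2) (2 * (u.re * v.re + u.im * v.im)) 0 := by
  have h1 : HasDerivAt (fun t : ℝ => u + t • v) v 0 := by
    simpa using ((hasDerivAt_id (0 : ℝ)).smul_const v).const_add u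
  have h2 := h1.norm_sq
  convert! h2 using 1
  simp [Complex.inner, mul_comm]

theorem hasDerivAt_line (a b : ℝ) : HasDerivAt (fun t : ℝ => a + t • b) b 0 := by
  simpa using ((hasDerivAt_id (0 : ℝ)).smul_const b).const_add a

theorem dForm_betaForm (k d : ℕ) (p v w : Ambient k d) :
    dForm (betaForm k d) p v w =
      ∑ l, (v.2.2 l * angularForm (p.1 l) (w.1 l) - w.2.2 l * angularForm (p.1 l) (v.1 l) +
        2 * p.2.2 l * angularForm (v.1 l) (w.1 l)) / (2 * Real.pi) +
      ∑ j, angularForm (v.2.1 j) (w.2.1 j) := by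
  have hd : DifferentiableAt ℝ (betaForm k d) p :=
    (contDiff_betaForm k d).contDiffAt.differentiableAt (by simp)
  have key (v w : Ambient k d) : fderiv ℝ (betaForm k d) p v w =
      ∑ l, (v.2.2 l / (2 * Real.pi) * angularForm (p.1 l) (w.1 l) +
        p.2.2 l / (2 * Real.pi) * angularForm (v.1 l) (w.1 l)) +
      ∑ j, 1 / 2 * angularForm (v.2.1 j) (w.2.1 j) := by
    apply fderiv_form_apply_eq_of_hasDerivAt hd
    simp only [betaForm_apply]
    refine (HasDerivAt.fun_sum fun l _ => ?_).add (HasDerivAt.fun_sum fun j _ => ?_)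
    · simpa using ((hasDerivAt_line (p.2.2 l) (v.2.2 l)).div_const (2 * Real.pi)).fun_mul
        (hasDerivAt_angularForm_line (p.1 l) (v.1 l) (w.1 l))
    · exact (hasDerivAt_angularForm_line (p.2.1 j) (v.2.1 j) (w.2.1 j)).const_mul _
  rw [dForm_eq hd, key, key, add_sub_add_comm, ← Finset.sum_sub_distrib,
    ← Finset.sum_sub_distrib]
  congr 1 <;> refine Finset.sum_congr rfl fun i _ => ?_ <;> simp only [angularForm_apply] <;> ring

/-- The defining function of `T^k × S^{2d+k-1}`. -/
noncomputable def torusSphereEq (k d : ℕ) (p : Ambient k d) : Fin k ⊕ Unit → ℝ :=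
  Sum.elim (fun l => ‖p.1 l‖ ^ 2 - 1) (fun _ => ∑ j, ‖p.2.1 j‖ ^ 2 + ∑ l, p.2.2 l ^ 2 - 1)

theorem mem_torusSphere_iff (k d : ℕ) (p : Ambient k d) :
    p ∈ torusSphere k d ↔ torusSphereEq k d p = 0 := by
  have h (x : ℂ) : ‖x‖ ^ 2 = 1 ↔ ‖x‖ = 1 := by
    rw [← pow_left_inj₀ (norm_nonneg x) zero_le_one two_ne_zero, one_pow]
  simp only [torusSphere, torusSphereEq, torus, funext_iff, sub_eq_zero, Set.mem_ofPred_eq,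
    Sum.forall, Sum.elim_inl, Sum.elim_inr, Pi.zero_apply, h, forall_const]

theorem contDiff_torusSphereEq (k d : ℕ) : ContDiff ℝ ∞ (torusSphereEq k d) := by
  have h (z : Ambient k d → ℂ) (hz : ContDiff ℝ ∞ z) : ContDiff ℝ ∞ fun p => ‖z p‖ ^ 2 :=
    hz.norm_sq ℝ
  rw [contDiff_pi]
  rintro (l | l)
  · exact (h (fun p => p.1 l) (by fun_prop)).sub contDiff_const
  · refine ((ContDiff.sum fun j _ => h (fun p => p.2.1 j) (by fun_prop)).add
      (ContDiff.sum fun l _ => ?_)).sub contDiff_const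
    fun_prop

theorem fderiv_torusSphereEq (k d : ℕ) (p v : Ambient k d) :
    fderiv ℝ (torusSphereEq k d) p v =
      Sum.elim (fun l => 2 * ((p.1 l).re * (v.1 l).re + (p.1 l).im * (v.1 l).im))
        (fun _ => ∑ j, 2 * ((p.2.1 j).re * (v.2.1 j).re + (p.2.1 j).im * (v.2.1 j).im) +
          ∑ l, 2 * (p.2.2 l * v.2.2 l)) := by
  apply fderiv_apply_eq_of_hasDerivAt
    ((contDiff_torusSphereEq k d).contDiffAt.differentiableAt (by simp))
  rw [hasDerivAt_pi]
  rintro (l | l)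
  · exact (hasDerivAt_norm_sq_line _ _).sub_const 1
  · refine ((HasDerivAt.fun_sum fun j _ => hasDerivAt_norm_sq_line _ _).add
      (HasDerivAt.fun_sum fun l _ => ?_)).sub_const 1
    convert! (hasDerivAt_line (p.2.2 l) (v.2.2 l)).pow 2 using 1
    simp [mul_assoc]

theorem fderiv_torusSphereEq_surjective {k d : ℕ} {p : Ambient k d} (hu : ∀ l, p.1 l ≠ 0)
    (hp : p.2 ≠ 0) : Function.Surjective (fderiv ℝ (torusSphereEq k d) p) := by
  intro y
  set N : ℝ := ∑ j, ((p.2.1 j).re ^ 2 + (p.2.1 j).im ^ 2) + ∑ l, p.2.2 l ^ 2 with hN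
  have hN0 : N ≠ 0 := by
    intro h0
    apply hp
    have h1 : 0 ≤ ∑ j, ((p.2.1 j).re ^ 2 + (p.2.1 j).im ^ 2) :=
      Finset.sum_nonneg fun _ _ => by positivity
    have h2 : 0 ≤ ∑ l, p.2.2 l ^ 2 := Finset.sum_nonneg fun _ _ => by positivity
    have h3 := (Finset.sum_eq_zero_iff_of_nonneg fun _ _ => by positivity).1
      (show ∑ j, ((p.2.1 j).re ^ 2 + (p.2.1 j).im ^ 2) = 0 by linarith)
    have h4 := (Finset.sum_eq_zero_iff_of_nonneg fun _ _ => by positivity).1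
      (show ∑ l, p.2.2 l ^ 2 = 0 by linarith)
    refine Prod.ext (funext fun j => ?_) (funext fun l => ?_)
    · have := h3 j (Finset.mem_univ _)
      apply Complex.ext <;> simp <;> nlinarith [sq_nonneg (p.2.1 j).re, sq_nonneg (p.2.1 j).im]
    · simpa using h4 l (Finset.mem_univ _)
  -- The equations are quadratic in separate blocks of variables, so radial vectors, suitably scaled
  -- in each block, already hit every value.
  refine ⟨(fun l => (y (Sum.inl l) / (2 * ((p.1 l).re ^ 2 + (p.1 l).im ^ 2))) • p.1 l,
    (y (Sum.inr ()) / (2 * N)) • p.2), ?_⟩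
  rw [fderiv_torusSphereEq]
  ext (l | l)
  · have h1 : ‖p.1 l‖ ^ 2 = (p.1 l).re ^ 2 + (p.1 l).im ^ 2 := by
      rw [Complex.sq_norm, Complex.normSq_apply]; ring
    have h2 : (p.1 l).re ^ 2 + (p.1 l).im ^ 2 ≠ 0 := by
      rw [← h1]; simpa using hu l
    simp only [Sum.elim_inl, Complex.real_smul, Complex.mul_re, Complex.mul_im,
      Complex.ofReal_re, Complex.ofReal_im, zero_mul, sub_zero, add_zero]
    field_simp
  · simp only [Sum.elim_inr, Prod.smul_fst, Prod.smul_snd, Pi.smul_apply, Complex.real_smul,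
      Complex.mul_re, Complex.mul_im, Complex.ofReal_re, Complex.ofReal_im, zero_mul, sub_zero,
      add_zero, smul_eq_mul]
    have : ∑ j, 2 * ((p.2.1 j).re * (y (Sum.inr ()) / (2 * N) * (p.2.1 j).re) +
        (p.2.1 j).im * (y (Sum.inr ()) / (2 * N) * (p.2.1 j).im)) +
        ∑ l, 2 * (p.2.2 l * (y (Sum.inr ()) / (2 * N) * p.2.2 l)) = y (Sum.inr ()) / N * N := by
      conv_rhs => rw [congrArg (y (Sum.inr ()) / N * ·) hN]
      conv_rhs => rw [ mul_add, Finset.mul_sum, Finset.mul_sum]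
      congr 1 <;> refine Finset.sum_congr rfl fun i _ => ?_ <;> field_simp
    rw [this]
    field_simp

theorem finrank_ambient (k d : ℕ) : Module.finrank ℝ (Ambient k d) = 3 * k + 2 * d := by
  simp [Ambient, Module.finrank_pi_fintype]
  ring

theorem ne_zero_of_mem_torus {ι : Type*} {s : ι → ℂ} (hs : s ∈ torus ι) (i : ι) : s i ≠ 0 := by
  rw [← norm_ne_zero_iff, hs i]; exact one_ne_zero

theorem snd_ne_zero_of_mem_torusSphere {k d : ℕ} {p : Ambient k d} (hp : p ∈ torusSphere k d) :
    p.2 ≠ 0 := by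
  intro h
  have := hp.2
  simp [h] at this

theorem isSubmanifold_torusSphere {k d n : ℕ} (hn : n + 1 = 2 * (k + d)) :
    IsSubmanifold n (torusSphere k d) := by
  refine isSubmanifold_of_local_zeroSet (ι := Fin k ⊕ Unit)
    (by rw [finrank_ambient]; simp; omega) fun p hp => ?_
  refine ⟨{q | (∀ l, q.1 l ≠ 0) ∧ q.2 ≠ 0}, ?_, ⟨ne_zero_of_mem_torus hp.1,
    snd_ne_zero_of_mem_torusSphere hp⟩, torusSphereEq k d, (contDiff_torusSphereEq k d).contDiffOn,
    fun q hq => fderiv_torusSphereEq_surjective hq.1 hq.2, fun q _ => mem_torusSphere_iff k d q⟩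
  have h : IsOpen {q : Ambient k d | ∀ l, q.1 l ≠ 0} := by
    rw [show {q : Ambient k d | ∀ l, q.1 l ≠ 0} = ⋂ l, {q : Ambient k d | q.1 l ≠ 0} by ext; simp]
    exact isOpen_iInter_of_finite fun l => isOpen_ne_fun (by fun_prop) (by fun_prop)
  exact h.and (isOpen_ne_fun (by fun_prop) (by fun_prop))

theorem mem_tangentSpace_torusSphere_iff_fderiv {k d : ℕ} {p : Ambient k d}
    (hp : p ∈ torusSphere k d) (v : Ambient k d) :
    v ∈ tangentSpace (torusSphere k d) p ↔ fderiv ℝ (torusSphereEq k d) p v = 0 := by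
  have hs : HasStrictFDerivAt (torusSphereEq k d) (fderiv ℝ (torusSphereEq k d) p) p :=
    (contDiff_torusSphereEq k d).contDiffAt.hasStrictFDerivAt (by simp)
  have h0 := (mem_torusSphere_iff k d p).1 hp
  refine ⟨apply_eq_zero_of_mem_tangentSpace hs.hasFDerivAt fun q hq => ?_,
    mem_tangentSpace_of_apply_eq_zero hs (fderiv_torusSphereEq_surjective
      (ne_zero_of_mem_torus hp.1) (snd_ne_zero_of_mem_torusSphere hp)) ?_⟩
  · rw [h0, (mem_torusSphere_iff k d q).1 hq]
  · exact Filter.Eventually.of_forall fun q hq =>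
      (mem_torusSphere_iff k d q).2 (hq.trans h0)

theorem mem_tangentSpace_torusSphere_iff {k d : ℕ} {p : Ambient k d} (hp : p ∈ torusSphere k d)
    (v : Ambient k d) : v ∈ tangentSpace (torusSphere k d) p ↔
      (∀ l, (p.1 l).re * (v.1 l).re + (p.1 l).im * (v.1 l).im = 0) ∧
      ∑ j, ((p.2.1 j).re * (v.2.1 j).re + (p.2.1 j).im * (v.2.1 j).im) +
          ∑ l, p.2.2 l * v.2.2 l = 0 := by
  rw [mem_tangentSpace_torusSphere_iff_fderiv hp, fderiv_torusSphereEq, funext_iff, Sum.forall]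
  simp only [Sum.elim_inl, Sum.elim_inr, Pi.zero_apply, ← Finset.mul_sum, ← mul_add]
  simp

theorem re_sq_add_im_sq_of_mem_torus {ι : Type*} {s : ι → ℂ} (hs : s ∈ torus ι) (i : ι) :
    (s i).re ^ 2 + (s i).im ^ 2 = 1 := by
  have h := Complex.sq_norm (s i)
  rw [hs i, Complex.normSq_apply] at h
  linarith

theorem differentiableAt_betaForm (k d : ℕ) (p : Ambient k d) :
    DifferentiableAt ℝ (betaForm k d) p :=
  (contDiff_betaForm k d).contDiffAt.differentiableAt (by simp)

theorem isContactForm_betaForm (k d : ℕ) : IsContactForm (torusSphere k d) (betaForm k d) := by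
  refine ⟨contDiff_betaForm k d, fun p hp => ?_⟩
  have hu := re_sq_add_im_sq_of_mem_torus hp.1
  set g : Ambient k d → ℝ := fun v => fderiv ℝ (torusSphereEq k d) p v (Sum.inr ()) with hg
  have hg_apply (v : Ambient k d) :
      g v = ∑ j, 2 * ((p.2.1 j).re * (v.2.1 j).re + (p.2.1 j).im * (v.2.1 j).im) +
          ∑ l, 2 * (p.2.2 l * v.2.2 l) := by
    simp only [hg, fderiv_torusSphereEq, Sum.elim_inr]
  have hT (v : Ambient k d) : v ∈ tangentSpace (torusSphere k d) p ↔
      (∀ l, (p.1 l).re * (v.1 l).re + (p.1 l).im * (v.1 l).im = 0) ∧ g v = 0 := by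
    rw [mem_tangentSpace_torusSphere_iff hp, hg_apply, ← Finset.mul_sum, ← Finset.mul_sum,
      ← mul_add]
    simp
  set D : ℝ := ∑ j, ((p.2.1 j).re ^ 2 + (p.2.1 j).im ^ 2) + ∑ l, 2 * p.2.2 l ^ 2 with hD
  have hD0 : 0 < D := by
    have h1 := hp.2
    simp only [Complex.sq_norm, Complex.normSq_apply, ← sq] at h1
    rw [hD, ← Finset.mul_sum]
    have : 0 ≤ ∑ l, p.2.2 l ^ 2 := Finset.sum_nonneg fun _ _ => sq_nonneg _
    linarith
  -- `Y` is half the Euler field of the weighted dilations `(u, tz, t²w)`. It is transverse to the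
  -- sphere and satisfies `dβ(v, Y) = -β(v)`. `R` is tangent, and `dβ(v, R) = g(v)` when `v` is
  -- tangent to the torus factor. The same number `D = ∑ |z_j|² + 2 ∑ w_l²` is both `g(Y)` and
  -- `β(R)`.
  set Y : Ambient k d := (0, (fun j => ⟨(p.2.1 j).re / 2, (p.2.1 j).im / 2⟩), p.2.2) with hY
  set R : Ambient k d := ((fun l => ⟨-(4 * Real.pi * p.2.2 l * (p.1 l).im),
    4 * Real.pi * p.2.2 l * (p.1 l).re⟩),
    (fun j => ⟨-(2 * (p.2.1 j).im), 2 * (p.2.1 j).re⟩), 0) with hR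
  have hgY : g Y = D := by
    rw [hg_apply, hD]
    congr 1 <;> refine Finset.sum_congr rfl fun i _ => ?_ <;> simp only [hY] <;> ring
  have hgR : g R = 0 := by
    rw [hg_apply]
    simp only [hR, Pi.zero_apply, mul_zero, Finset.sum_const_zero, add_zero]
    refine Finset.sum_eq_zero fun i _ => ?_
    ring
  have hβY : betaForm k d p Y = 0 := by
    rw [betaForm_apply]
    have h (i : Fin d) : angularForm (p.2.1 i) (Y.2.1 i) = 0 := by
      simp only [hY, angularForm_apply]
      ring
    simp only [h, mul_zero, Finset.sum_const_zero, add_zero]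
    exact Finset.sum_eq_zero fun l _ => by simp [hY]
  have hβR : betaForm k d p R = D := by
    rw [betaForm_apply, hD, add_comm]
    congr 1 <;> refine Finset.sum_congr rfl fun i _ => ?_ <;>
      simp only [hR, angularForm_apply]
    · ring
    · have := hu i
      have : (p.1 i).re * (4 * Real.pi * p.2.2 i * (p.1 i).re) -
        (p.1 i).im * -(4 * Real.pi * p.2.2 i * (p.1 i).im) = 4 * Real.pi * p.2.2 i := by
        linear_combination 4 * Real.pi * p.2.2 i * this
      rw [this]
      field_simp
      ring
  have hRT : R ∈ tangentSpace (torusSphere k d) p :=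
    (hT R).2 ⟨fun l => by simp only [hR]; ring, hgR⟩
  refine ⟨⟨R, hRT, by rw [hβR]; exact hD0.ne'⟩, fun v hv hβv hω => ?_⟩
  obtain ⟨hv1, hv2⟩ := (hT v).1 hv
  -- The image of `v` under a complex structure for which `dβ(v, x)` is a sum of squares vanishing
  -- only for `v = 0`.
  set x : Ambient k d := ((fun l => ⟨-(v.2.2 l * (p.1 l).im), v.2.2 l * (p.1 l).re⟩),
    (fun j => ⟨-(v.2.1 j).im, (v.2.1 j).re⟩), fun l => -angularForm (p.1 l) (v.1 l)) with hx
  have hvY : dForm (betaForm k d) p v Y = 0 := by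
    rw [dForm_betaForm, ← neg_eq_zero, ← hβv, betaForm_apply, neg_add, ← Finset.sum_neg_distrib,
      ← Finset.sum_neg_distrib]
    congr 1 <;> refine Finset.sum_congr rfl fun i _ => ?_ <;> simp only [hY, angularForm_apply]
    · simp
      ring
    · ring
  have hvR : dForm (betaForm k d) p v R = 0 := by
    rw [dForm_betaForm, ← hv2, hg_apply, add_comm]
    congr 1 <;> refine Finset.sum_congr rfl fun i _ => ?_ <;> simp only [hR, angularForm_apply]
    · ring
    · have h1 := hu i
      have h2 := hv1 i
      simp only [Pi.zero_apply]
      field_simp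
      linear_combination 4 * Real.pi * (v.2.2 i * p.2.2 i) * h1 + 8 * Real.pi * p.2.2 i ^ 2 * h2
  have hvx : dForm (betaForm k d) p v x = 0 := by
    -- `x` is generally neither tangent nor in `ker β`. Subtracting a multiple of `Y` makes it
    -- tangent and subtracting a multiple of `R` puts it in `ker β`. Neither correction affects the
    -- pairing with `v`, as `β(v) = g(v) = 0`.
    set c := g x / D
    set b := betaForm k d p x / D
    have h1 := hω (x - c • Y - b • R) ?_ ?_
    · rw [dForm_eq (differentiableAt_betaForm k d p)] at h1 hvY hvR ⊢
      simp only [map_sub, map_smul, sub_apply, smul_apply,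
        smul_eq_mul] at h1
      linear_combination h1 + c * hvY + b * hvR
    · rw [hT]
      refine ⟨fun l => ?_, ?_⟩
      · simp [hx, hY, hR]
        ring
      · have : g (x - c • Y - b • R) = g x - c * g Y - b * g R := by
          simp [hg]
        rw [this, hgY, hgR]
        simp only [c]
        field_simp
        ring
    · simp only [map_sub, map_smul, smul_eq_mul, hβY, hβR, b]
      field_simp
      ring
  have hsum : dForm (betaForm k d) p v x =
      ∑ l, (v.2.2 l ^ 2 + angularForm (p.1 l) (v.1 l) ^ 2) / (2 * Real.pi) +
      ∑ j, ((v.2.1 j).re ^ 2 + (v.2.1 j).im ^ 2) := by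
    rw [dForm_betaForm]
    congr 1 <;> refine Finset.sum_congr rfl fun i _ => ?_ <;> simp only [hx, angularForm_apply]
    · have h1 := hu i
      have h2 := hv1 i
      field_simp
      linear_combination v.2.2 i ^ 2 * h1 + 2 * p.2.2 i * v.2.2 i * h2
    · ring
  rw [hvx] at hsum
  have h1 : 0 ≤ ∑ l, (v.2.2 l ^ 2 + angularForm (p.1 l) (v.1 l) ^ 2) / (2 * Real.pi) :=
    Finset.sum_nonneg fun _ _ => by positivity
  have h2 : 0 ≤ ∑ j, ((v.2.1 j).re ^ 2 + (v.2.1 j).im ^ 2) :=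
    Finset.sum_nonneg fun _ _ => by positivity
  have h3 := (Finset.sum_eq_zero_iff_of_nonneg fun _ _ => by positivity).1
    (show ∑ l, (v.2.2 l ^ 2 + angularForm (p.1 l) (v.1 l) ^ 2) / (2 * Real.pi) = 0 by linarith)
  have h4 := (Finset.sum_eq_zero_iff_of_nonneg fun _ _ => by positivity).1
    (show ∑ j, ((v.2.1 j).re ^ 2 + (v.2.1 j).im ^ 2) = 0 by linarith)
  have h5 (l) : v.2.2 l = 0 ∧ angularForm (p.1 l) (v.1 l) = 0 := by
    have h6 := h3 l (Finset.mem_univ _)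
    have h7 : v.2.2 l ^ 2 + angularForm (p.1 l) (v.1 l) ^ 2 = 0 := by
      rcases div_eq_zero_iff.1 h6 with h | h
      · exact h
      · exact absurd h (by positivity)
    exact ⟨by nlinarith [sq_nonneg (v.2.2 l), sq_nonneg (angularForm (p.1 l) (v.1 l))],
      by nlinarith [sq_nonneg (v.2.2 l), sq_nonneg (angularForm (p.1 l) (v.1 l))]⟩
  refine Prod.ext (funext fun l => ?_) (Prod.ext (funext fun j => ?_) (funext fun l => (h5 l).1))
  · have h6 := (h5 l).2
    rw [angularForm_apply] at h6
    have h7 := hv1 l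
    have h8 := hu l
    apply Complex.ext
    · simp only [Prod.fst_zero, Pi.zero_apply, Complex.zero_re]
      linear_combination (p.1 l).re * h7 - (p.1 l).im * h6 - (v.1 l).re * h8
    · simp only [Prod.fst_zero, Pi.zero_apply, Complex.zero_im]
      linear_combination (p.1 l).im * h7 + (p.1 l).re * h6 - (v.1 l).im * h8
  · have h6 := h4 j (Finset.mem_univ _)
    apply Complex.ext <;> simp <;> nlinarith [sq_nonneg (v.2.1 j).re, sq_nonneg (v.2.1 j).im]

/-! ### The torus action, its moment map and the failure of Reeb type. -/

theorem angularForm_mul_mul (s u v : ℂ) :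
    angularForm (s * u) (s * v) = ‖s‖ ^ 2 * angularForm u v := by
  rw [Complex.sq_norm, Complex.normSq_apply]
  simp only [angularForm_apply, Complex.mul_re, Complex.mul_im]
  ring

theorem isLinearMap_toricAction (k d : ℕ) (s : Fin k ⊕ Fin d → ℂ) :
    IsLinearMap ℝ (toricAction k d s) where
  map_add p q := by
    refine Prod.ext (funext fun l => ?_) (Prod.ext (funext fun l => ?_) rfl) <;>
      simp [toricAction, mul_add]
  map_smul a p := by
    refine Prod.ext (funext fun l => ?_) (Prod.ext (funext fun l => ?_) rfl) <;>
      simp [toricAction, mul_left_comm]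

theorem fderivWithin_toricAction {k d : ℕ} {s : Fin k ⊕ Fin d → ℂ} {X : Set (Ambient k d)}
    {p v : Ambient k d} (hv : v ∈ tangentSpace X p) :
    fderivWithin ℝ (toricAction k d s) X p v = toricAction k d s v :=
  fderivWithin_of_mem_tangentSpace (LinearMap.toContinuousLinearMap
    (isLinearMap_toricAction k d s).mk').hasFDerivAt.hasFDerivWithinAt hv

theorem contDiff_toricAction (k d : ℕ) :
    ContDiff ℝ ∞ fun x : (Fin k ⊕ Fin d → ℂ) × Ambient k d => toricAction k d x.1 x.2 := by
  unfold toricAction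
  fun_prop

theorem isInvariantTorusAction_toricAction (k d : ℕ) :
    IsInvariantTorusAction (torusSphere k d) (betaForm k d) (toricAction k d) where
  mapsTo s hs p hp := by
    refine ⟨fun l => ?_, ?_⟩
    · simp [toricAction, hs (Sum.inl l), hp.1 l]
    · simpa [toricAction, hs (Sum.inr _)] using hp.2
  one p _ := by simp [toricAction]
  mul s _ t _ p _ := by simp [toricAction, mul_assoc]
  smooth := (contDiff_toricAction k d).contDiffOn
  invariant s hs p _ v hv := by
    rw [fderivWithin_toricAction hv]
    simp [betaForm_apply, toricAction, angularForm_mul_mul, hs (Sum.inl _), hs (Sum.inr _)]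

theorem isToricContact_torusSphere {k d : ℕ} (hd : 0 < d) :
    IsToricContact (torusSphere k d) (betaForm k d) (toricAction k d) where
  submanifold := ⟨2 * (k + d) - 1, by simp; omega, isSubmanifold_torusSphere (by omega)⟩
  contact := isContactForm_betaForm k d
  action := isInvariantTorusAction_toricAction k d
  effective s hs h := by
    -- At the point with `u = 1`, `z = e_j` the action displays every `s_l` and the `j`-th circle
    -- coordinate. The `T^k` coordinates need at least one such point, hence `0 < d`.
    have key (j : Fin d) := h ((1, Pi.single j 1, 0) : Ambient k d) (by
      refine ⟨fun l => by simp, ?_⟩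
      rw [Finset.sum_eq_single j (fun b _ hb => by simp [hb]) (by simp)]
      simp)
    ext (l | j)
    · simpa [toricAction] using congrFun (congrArg Prod.fst (key ⟨0, hd⟩)) l
    · simpa [toricAction] using congrFun (congrArg (fun x => x.2.1) (key j)) j

theorem torusExp_mem_torus {ι : Type*} (X : ι → ℝ) : torusExp X ∈ torus ι := by
  intro i
  rw [torusExp, show (2 * Real.pi * Complex.I * (X i : ℂ)) =
    ((2 * Real.pi * X i : ℝ) : ℂ) * Complex.I by push_cast; ring, Complex.norm_exp_ofReal_mul_I]

theorem hasDerivAt_torusExp {ι : Type*} (X : ι → ℝ) (i : ι) :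
    HasDerivAt (fun t : ℝ => torusExp (t • X) i) (2 * Real.pi * Complex.I * X i) 0 := by
  have h1 : HasDerivAt (fun t : ℝ => 2 * Real.pi * Complex.I * (((t • X) i : ℝ) : ℂ))
      (2 * Real.pi * Complex.I * X i) 0 := by
    have := ((hasDerivAt_id (0 : ℝ)).mul_const (X i)).ofReal_comp
    simpa using this.const_mul (2 * Real.pi * Complex.I)
  simpa [torusExp] using h1.cexp

theorem hasDerivAt_toricAction (k d : ℕ) (X : Fin k ⊕ Fin d → ℝ) (p : Ambient k d) :
    HasDerivAt (fun t : ℝ => toricAction k d (torusExp (t • X)) p)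
      ((fun l => 2 * Real.pi * Complex.I * X (Sum.inl l) * p.1 l),
        (fun j => 2 * Real.pi * Complex.I * X (Sum.inr j) * p.2.1 j), 0) 0 := by
  refine HasDerivAt.prodMk ?_ (HasDerivAt.prodMk ?_ (hasDerivAt_const _ _))
  · rw [hasDerivAt_pi]
    exact fun l => (hasDerivAt_torusExp X (Sum.inl l)).mul_const _
  · rw [hasDerivAt_pi]
    exact fun j => (hasDerivAt_torusExp X (Sum.inr j)).mul_const _

theorem fundamentalField_toricAction (k d : ℕ) (X : Fin k ⊕ Fin d → ℝ) (p : Ambient k d) :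
    fundamentalField (toricAction k d) X p =
      ((fun l => 2 * Real.pi * Complex.I * X (Sum.inl l) * p.1 l),
        (fun j => 2 * Real.pi * Complex.I * X (Sum.inr j) * p.2.1 j), 0) :=
  (hasDerivAt_toricAction k d X p).deriv

theorem fundamentalField_mem_tangentSpace {k d : ℕ} (X : Fin k ⊕ Fin d → ℝ) {p : Ambient k d}
    (hp : p ∈ torusSphere k d) :
    fundamentalField (toricAction k d) X p ∈ tangentSpace (torusSphere k d) p := by
  have h := mem_tangentSpace_of_curve (hasDerivAt_toricAction k d X p)
    fun t => (isInvariantTorusAction_toricAction k d).mapsTo _ (torusExp_mem_torus (t • X)) hp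
  rw [fundamentalField_toricAction]
  have h0 : torusExp ((0 : ℝ) • X) = 1 := by funext i; simp [torusExp]
  rwa [h0, (isInvariantTorusAction_toricAction k d).one p hp] at h

theorem angularForm_rotation (a : ℝ) (u : ℂ) :
    angularForm u (2 * Real.pi * Complex.I * a * u) = 2 * Real.pi * a * ‖u‖ ^ 2 := by
  rw [Complex.sq_norm, Complex.normSq_apply, show (2 * Real.pi * Complex.I * a * u : ℂ) =
    ((2 * Real.pi * a : ℝ) : ℂ) * (Complex.I * u) by push_cast; ring]
  simp only [angularForm_apply, Complex.re_ofReal_mul, Complex.im_ofReal_mul, Complex.I_mul_re,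
    Complex.I_mul_im]
  ring

theorem betaForm_fundamentalField (k d : ℕ) (X : Fin k ⊕ Fin d → ℝ) (p : Ambient k d) :
    betaForm k d p (fundamentalField (toricAction k d) X p) =
      ∑ l, p.2.2 l * ‖p.1 l‖ ^ 2 * X (Sum.inl l) +
        ∑ j, Real.pi * ‖p.2.1 j‖ ^ 2 * X (Sum.inr j) := by
  rw [betaForm_apply, fundamentalField_toricAction]
  simp only [angularForm_rotation]
  congr 1 <;> refine Finset.sum_congr rfl fun i _ => ?_ <;> field_simp

theorem momentMap_toricAction (k d : ℕ) (p : Ambient k d) :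
    momentMap (betaForm k d) (toricAction k d) p =
      Sum.elim (fun l => p.2.2 l * ‖p.1 l‖ ^ 2) (fun j => Real.pi * ‖p.2.1 j‖ ^ 2) := by
  ext (l | j)
  · simp only [momentMap, betaForm_fundamentalField, Sum.elim_inl]
    simp [Pi.single_apply]
  · simp only [momentMap, betaForm_fundamentalField, Sum.elim_inr]
    simp [Pi.single_apply]

theorem momentMap_firstAction (k d : ℕ) (p : Ambient k d) :
    momentMap (betaForm k d) (firstAction k d) p = fun l => p.2.2 l * ‖p.1 l‖ ^ 2 := by
  have h : fundamentalField (firstAction k d) = fun (X : Fin k → ℝ) p =>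
      fundamentalField (toricAction k d) (Sum.elim X 0) p := by
    funext X p
    simp only [fundamentalField, firstAction]
    congr 1
    funext t
    congr 1
    ext (l | j) <;> simp [torusExp]
  funext l
  simp only [momentMap, h, betaForm_fundamentalField]
  simp [Pi.single_apply]

/-- Only the normalization `α'(X) = 1` is needed. Where `z = 0` and `w = ±e_l`, it makes `X_l` and
`-X_l` positive at once. -/
theorem not_isReebType {k d : ℕ} (hk : 1 ≤ k) :
    ¬ IsReebType (torusSphere k d) (betaForm k d) (toricAction k d) := by
  rintro ⟨α, -, hα, X, hX⟩
  have key (ε : ℝ) (hε : ε ^ 2 = 1) : 0 < ε * X (Sum.inl ⟨0, hk⟩) := by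
    have hp : ((1, 0, Pi.single ⟨0, hk⟩ ε) : Ambient k d) ∈ torusSphere k d := by
      refine ⟨fun l => by simp, ?_⟩
      rw [Finset.sum_eq_single (⟨0, hk⟩ : Fin k) (fun b _ hb => by simp [hb]) (by simp)]
      simp [hε]
    obtain ⟨r, hr, h⟩ := hα _ hp
    have h1 := (hX _ hp).1
    rw [h _ (fundamentalField_mem_tangentSpace X hp), betaForm_fundamentalField] at h1
    simp [Pi.single_apply] at h1
    exact pos_of_mul_pos_right (h1.symm ▸ one_pos) hr.le
  have h1 := key 1 (by norm_num)
  have h2 := key (-1) (by norm_num)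
  linarith

/-! ### The sphere as a contact reduction. -/

theorem zeroLevel_firstAction (k d : ℕ) :
    zeroLevel (torusSphere k d) (betaForm k d) (firstAction k d) =
      {p | p ∈ torusSphere k d ∧ p.2.2 = 0} := by
  ext p
  refine and_congr_right fun hp => ?_
  have h (l) : ‖p.1 l‖ = 1 := hp.1 l
  rw [momentMap_firstAction]
  simp [funext_iff, h]

theorem isInvariantTorusAction_firstAction (k d : ℕ) :
    IsInvariantTorusAction (torusSphere k d) (betaForm k d) (firstAction k d) := by
  have hA := isInvariantTorusAction_toricAction k d
  have hs {s : Fin k → ℂ} (hs : s ∈ torus (Fin k)) :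
      (Sum.elim s 1 : Fin k ⊕ Fin d → ℂ) ∈ torus (Fin k ⊕ Fin d) := by
    rintro (l | j)
    · exact hs l
    · simp
  refine ⟨fun s h => hA.mapsTo _ (hs h), fun p hp => ?_, fun s h t h' p hp => ?_, ?_,
    fun s h => hA.invariant _ (hs h)⟩
  · rw [firstAction, Sum.elim_one_one, hA.one p hp]
  · rw [firstAction, firstAction, firstAction, ← hA.mul _ (hs h) _ (hs h') p hp]
    congr 1
    ext (l | j) <;> simp
  · unfold firstAction toricAction
    simp only [Sum.elim_inl, Sum.elim_inr]
    fun_prop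

theorem isContactReduction_torusSphere (k d : ℕ) :
    IsContactReduction (torusSphere k d) (betaForm k d) (firstAction k d)
      (stdSphere d) (stdForm d) (reductionMap k d) := by
  let ρ : Ambient k d →L[ℝ] (Fin d → ℂ) :=
    (ContinuousLinearMap.fst ℝ _ _).comp (ContinuousLinearMap.snd ℝ _ _)
  have hρ (p : Ambient k d) : HasFDerivAt (reductionMap k d) ρ p := ρ.hasFDerivAt
  refine ⟨isInvariantTorusAction_firstAction k d, ?_, ?_, ?_, ?_, ?_, ?_, ?_, ?_⟩ <;>
    rw [zeroLevel_firstAction]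
  · rintro p ⟨hp, hw⟩ y
    let W : Ambient k d →L[ℝ] (Fin k → ℝ) :=
      (ContinuousLinearMap.snd ℝ _ _).comp (ContinuousLinearMap.snd ℝ _ _)
    have hv : ((0, 0, y) : Ambient k d) ∈ tangentSpace (torusSphere k d) p := by
      rw [mem_tangentSpace_torusSphere_iff hp]
      simp [hw]
    refine ⟨(0, 0, y), hv, ?_⟩
    -- On the manifold `|u_l| = 1`, so the moment map agrees there with the linear projection to
    -- `w`, which can replace it when differentiating.
    have h (q) (hq : q ∈ torusSphere k d) :
        momentMap (betaForm k d) (firstAction k d) q = W q := by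
      have h (l) : ‖q.1 l‖ = 1 := hq.1 l
      rw [momentMap_firstAction]
      simp [h, W]
    rw [fderivWithin_of_mem_tangentSpace (f' := W) _ hv]
    · simp [W]
    · exact W.hasFDerivAt.hasFDerivWithinAt.congr h (h p hp)
  · rintro p ⟨hp, -⟩ s _ h
    funext l
    have := congrFun (congrArg Prod.fst h) l
    simpa [firstAction, toricAction, ne_zero_of_mem_torus hp.1 l] using this
  · rintro p ⟨hp, hw⟩
    have h := hp.2
    simpa [hw, stdSphere, reductionMap] using h
  · intro z hz
    have hz' : ∑ j, ‖z j‖ ^ 2 = 1 := hz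
    exact ⟨(1, z, 0), ⟨⟨fun l => by simp, by simpa using hz'⟩, rfl⟩, rfl⟩
  · exact ρ.contDiff.contDiffOn
  · rintro p ⟨hp, hpw⟩ q ⟨hq, hqw⟩
    constructor
    · intro h
      refine ⟨fun l => q.1 l / p.1 l, fun l => ?_, ?_⟩
      · have h1 : ‖q.1 l‖ = 1 := hq.1 l
        have h2 : ‖p.1 l‖ = 1 := hp.1 l
        simp [h1, h2]
      · refine Prod.ext (funext fun l => ?_) (Prod.ext (funext fun j => ?_) (hpw.trans hqw.symm))
        · simp [firstAction, toricAction, ne_zero_of_mem_torus hp.1 l]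
        · simpa [firstAction, toricAction, reductionMap] using congrFun h j
    · rintro ⟨s, -, rfl⟩
      simp [firstAction, toricAction, reductionMap]
  · rintro p ⟨hp, hw⟩ y hy
    -- A tangent vector of the sphere is lifted by the section `z ↦ (u, z, 0)` with `u` frozen at
    -- the given point.
    let i : (Fin d → ℂ) →L[ℝ] Ambient k d :=
      (ContinuousLinearMap.inr ℝ _ _).comp (ContinuousLinearMap.inl ℝ _ _)
    have hi : HasFDerivAt (fun z : Fin d → ℂ => ((p.1, z, 0) : Ambient k d)) i p.2.1 := by
      have := i.hasFDerivAt (x := p.2.1).const_add ((p.1, 0, 0) : Ambient k d)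
      convert! this using 1
      funext z
      simp [i]
    have hv : i y ∈ tangentSpace {p | p ∈ torusSphere k d ∧ p.2.2 = 0} p := by
      have := mem_tangentSpace_of_mapsTo (Y := {p | p ∈ torusSphere k d ∧ p.2.2 = 0})
        hi.hasFDerivWithinAt (fun z (hz : ∑ j, ‖z j‖ ^ 2 = 1) => ?_) hy
      · rwa [show ((p.1, p.2.1, 0) : Ambient k d) = p from
          Prod.ext rfl (Prod.ext rfl hw.symm)] at this
      · exact ⟨⟨hp.1, by simpa using hz⟩, rfl⟩
    refine ⟨i y, hv, ?_⟩
    rw [fderivWithin_of_mem_tangentSpace (hρ p).hasFDerivWithinAt hv]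
    simp [ρ, i]
  · rintro p ⟨hp, hw⟩ v hv
    rw [fderivWithin_of_mem_tangentSpace (hρ p).hasFDerivWithinAt hv, betaForm_apply,
      stdForm_apply]
    simp [hw, reductionMap, ρ]

/-! ### Pre-Lagrangian toric fibers over `w = 0`. -/

/-- The defining function of `{(u, z, 0) : |u_l| = 1, |z_j| = c_j}`. -/
noncomputable def toricFiberEq (k d : ℕ) (c : Fin d → ℝ) (p : Ambient k d) :
    (Fin k ⊕ Fin d) ⊕ Fin k → ℝ :=
  Sum.elim (Sum.elim (fun l => ‖p.1 l‖ ^ 2 - 1) (fun j => ‖p.2.1 j‖ ^ 2 - c j ^ 2)) p.2.2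

theorem mem_toricFiber_iff {k d : ℕ} {c : Fin d → ℝ} (hc : ∀ j, 0 < c j)
    (hc1 : ∑ j, c j ^ 2 = 1) (p : Ambient k d) :
    p ∈ toricFiber k d c 0 ↔ toricFiberEq k d c p = 0 := by
  have h (x : ℂ) (r : ℝ) (hr : 0 ≤ r) : ‖x‖ ^ 2 = r ^ 2 ↔ ‖x‖ = r :=
    pow_left_inj₀ (norm_nonneg x) hr two_ne_zero
  have h1 (x : ℂ) : ‖x‖ ^ 2 = 1 ↔ ‖x‖ = 1 := by simpa using h x 1 zero_le_one
  simp only [toricFiberEq, funext_iff, sub_eq_zero, Sum.forall, Sum.elim_inl, Sum.elim_inr,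
    Pi.zero_apply, h _ _ (hc _).le, h1]
  constructor
  · rintro ⟨hp, hw, hz⟩
    exact ⟨⟨hp.1, hz⟩, fun l => congrFun hw l⟩
  · rintro ⟨⟨hu, hz⟩, hw⟩
    exact ⟨⟨hu, by simp [hz, hw, hc1]⟩, funext hw, hz⟩

theorem contDiff_toricFiberEq (k d : ℕ) (c : Fin d → ℝ) : ContDiff ℝ ∞ (toricFiberEq k d c) := by
  have h (z : Ambient k d → ℂ) (hz : ContDiff ℝ ∞ z) : ContDiff ℝ ∞ fun p => ‖z p‖ ^ 2 :=
    hz.norm_sq ℝ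
  rw [contDiff_pi]
  rintro ((l | j) | l)
  · exact (h (fun p => p.1 l) (by fun_prop)).sub contDiff_const
  · exact (h (fun p => p.2.1 j) (by fun_prop)).sub contDiff_const
  · simp only [toricFiberEq, Sum.elim_inr]
    fun_prop

theorem fderiv_toricFiberEq (k d : ℕ) (c : Fin d → ℝ) (p v : Ambient k d) :
    fderiv ℝ (toricFiberEq k d c) p v =
      Sum.elim (Sum.elim (fun l => 2 * ((p.1 l).re * (v.1 l).re + (p.1 l).im * (v.1 l).im))
        (fun j => 2 * ((p.2.1 j).re * (v.2.1 j).re + (p.2.1 j).im * (v.2.1 j).im))) v.2.2 := by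
  apply fderiv_apply_eq_of_hasDerivAt
    ((contDiff_toricFiberEq k d c).contDiffAt.differentiableAt (by simp))
  rw [hasDerivAt_pi]
  rintro ((l | j) | l)
  · exact (hasDerivAt_norm_sq_line _ _).sub_const _
  · exact (hasDerivAt_norm_sq_line _ _).sub_const _
  · exact hasDerivAt_line _ _

theorem exists_two_mul_inner_eq {z : ℂ} (hz : z ≠ 0) (y : ℝ) :
    ∃ v : ℂ, 2 * (z.re * v.re + z.im * v.im) = y := by
  have h : z.re ^ 2 + z.im ^ 2 ≠ 0 := by
    intro h
    exact hz (Complex.ext (by simp; nlinarith [sq_nonneg z.re, sq_nonneg z.im])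
      (by simp; nlinarith [sq_nonneg z.re, sq_nonneg z.im]))
  refine ⟨⟨y / (2 * (z.re ^ 2 + z.im ^ 2)) * z.re, y / (2 * (z.re ^ 2 + z.im ^ 2)) * z.im⟩, ?_⟩
  field_simp

theorem isSubmanifold_toricFiber {k d : ℕ} {c : Fin d → ℝ} (hc : ∀ j, 0 < c j)
    (hc1 : ∑ j, c j ^ 2 = 1) : IsSubmanifold (k + d) (toricFiber k d c 0) := by
  refine isSubmanifold_of_local_zeroSet (ι := (Fin k ⊕ Fin d) ⊕ Fin k)
    (by rw [finrank_ambient]; simp; omega) fun p hp => ?_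
  refine ⟨{q | (∀ l, q.1 l ≠ 0) ∧ ∀ j, q.2.1 j ≠ 0}, ?_,
    ⟨ne_zero_of_mem_torus hp.1.1, fun j => ?_⟩, toricFiberEq k d c,
    (contDiff_toricFiberEq k d c).contDiffOn, ?_, fun q _ => mem_toricFiber_iff hc hc1 q⟩
  · have h : IsOpen {q : Ambient k d | ∀ l, q.1 l ≠ 0} := by
      rw [show {q : Ambient k d | ∀ l, q.1 l ≠ 0} = ⋂ l, {q : Ambient k d | q.1 l ≠ 0} by
        ext; simp]
      exact isOpen_iInter_of_finite fun l => isOpen_ne_fun (by fun_prop) (by fun_prop)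
    have h' : IsOpen {q : Ambient k d | ∀ j, q.2.1 j ≠ 0} := by
      rw [show {q : Ambient k d | ∀ j, q.2.1 j ≠ 0} = ⋂ j, {q : Ambient k d | q.2.1 j ≠ 0} by
        ext; simp]
      exact isOpen_iInter_of_finite fun l => isOpen_ne_fun (by fun_prop) (by fun_prop)
    exact h.and h'
  · rw [← norm_ne_zero_iff, hp.2.2 j]
    exact (hc j).ne'
  · rintro q ⟨hq1, hq2⟩ y
    choose υ hυ using fun l => exists_two_mul_inner_eq (hq1 l) (y (Sum.inl (Sum.inl l)))
    choose ζ hζ using fun j => exists_two_mul_inner_eq (hq2 j) (y (Sum.inl (Sum.inr j)))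
    refine ⟨(υ, ζ, fun l => y (Sum.inr l)), ?_⟩
    rw [fderiv_toricFiberEq]
    ext ((l | j) | l)
    · exact hυ l
    · exact hζ j
    · rfl

/-- Two vectors of the plane orthogonal to the same nonzero vector are parallel, and the area form
vanishes on parallel vectors. -/
theorem angularForm_eq_zero_of_orthogonal {z v w : ℂ} (hz : z ≠ 0)
    (hv : 2 * (z.re * v.re + z.im * v.im) = 0) (hw : 2 * (z.re * w.re + z.im * w.im) = 0) :
    angularForm v w = 0 := by
  rw [angularForm_apply]
  by_contra h
  refine hz (Complex.ext ?_ ?_)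
  · refine (mul_eq_zero.1 (?_ : z.re * (v.re * w.im - v.im * w.re) = 0)).resolve_right h
    linear_combination w.im / 2 * hv - v.im / 2 * hw
  · refine (mul_eq_zero.1 (?_ : z.im * (v.re * w.im - v.im * w.re) = 0)).resolve_right h
    linear_combination v.re / 2 * hw - w.re / 2 * hv

/-- Tangent vectors have no `w`-component, and each of their complex components is tangent to a
circle, so every term of `dβ_k` vanishes separately. -/
theorem dForm_betaForm_of_mem_tangentSpace_toricFiber {k d : ℕ} {c : Fin d → ℝ}
    (hc : ∀ j, 0 < c j) (hc1 : ∑ j, c j ^ 2 = 1) {p v w : Ambient k d}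
    (hp : p ∈ toricFiber k d c 0) (hv : v ∈ tangentSpace (toricFiber k d c 0) p)
    (hw : w ∈ tangentSpace (toricFiber k d c 0) p) : dForm (betaForm k d) p v w = 0 := by
  have key {v : Ambient k d} (hv : v ∈ tangentSpace (toricFiber k d c 0) p) (i) :=
    congrFun ((fderiv_toricFiberEq k d c p v).symm.trans (apply_eq_zero_of_mem_tangentSpace
      ((contDiff_toricFiberEq k d c).contDiffAt.differentiableAt (by simp)).hasFDerivAt
      (fun q hq => ((mem_toricFiber_iff hc hc1 q).1 hq).trans
        ((mem_toricFiber_iff hc hc1 p).1 hp).symm) hv)) i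
  have hz (j) : p.2.1 j ≠ 0 := by
    rw [← norm_ne_zero_iff, hp.2.2 j]
    exact (hc j).ne'
  have h1 (l) : angularForm (v.1 l) (w.1 l) = 0 :=
    angularForm_eq_zero_of_orthogonal (ne_zero_of_mem_torus hp.1.1 l)
      (key hv (Sum.inl (Sum.inl l))) (key hw (Sum.inl (Sum.inl l)))
  have h2 (j) : angularForm (v.2.1 j) (w.2.1 j) = 0 :=
    angularForm_eq_zero_of_orthogonal (hz j)
      (key hv (Sum.inl (Sum.inr j))) (key hw (Sum.inl (Sum.inr j)))
  have h3 (l) : v.2.2 l = 0 := key hv (Sum.inr l)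
  have h4 (l) : w.2.2 l = 0 := key hw (Sum.inr l)
  rw [dForm_betaForm]
  simp [h1, h2, h3, h4]

theorem toricFiber_eq_orbit {k d : ℕ} {c : Fin d → ℝ} (hc : ∀ j, 0 < c j)
    (hc1 : ∑ j, c j ^ 2 = 1) :
    ((1, fun j => (c j : ℂ), 0) : Ambient k d) ∈ torusSphere k d ∧
    toricFiber k d c 0 = (fun s => toricAction k d s (1, fun j => (c j : ℂ), 0)) ''
      torus (Fin k ⊕ Fin d) := by
  have hp : ((1, fun j => (c j : ℂ), 0) : Ambient k d) ∈ torusSphere k d :=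
    ⟨fun l => by simp, by simp [hc1]⟩
  refine ⟨hp, Set.Subset.antisymm (fun p hpc => ?_) ?_⟩
  · obtain ⟨hpV, hw, hz⟩ := hpc
    have hc' (j) : (c j : ℂ) ≠ 0 := by exact_mod_cast (hc j).ne'
    refine ⟨Sum.elim p.1 fun j => p.2.1 j / c j, ?_, ?_⟩
    · rintro (l | j)
      · exact hpV.1 l
      · simp [hz j, abs_of_pos (hc j), (hc j).ne']
    · refine Prod.ext (funext fun l => ?_) (Prod.ext (funext fun j => ?_) hw.symm)
      · simp [toricAction]
      · simp [toricAction, hc' j]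
  · rintro _ ⟨s, hs, rfl⟩
    refine ⟨(isInvariantTorusAction_toricAction k d).mapsTo s hs hp, rfl, fun j => ?_⟩
    simp [toricAction, hs (Sum.inr j), abs_of_pos (hc j)]

theorem isPreLagrangianToricFiber_toricFiber {k d : ℕ} (hd : 0 < d) {c : Fin d → ℝ}
    (hc : ∀ j, 0 < c j) (hc1 : ∑ j, c j ^ 2 = 1) :
    IsPreLagrangianToricFiber (torusSphere k d) (betaForm k d) (toricAction k d)
      (toricFiber k d c 0) :=
  ⟨⟨_, toricFiber_eq_orbit hc hc1⟩,
    isPreLagrangian_of_isotropic (n := k + d) (m := 2 * (k + d) - 1) (by omega)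
      (differentiableAt_betaForm k d) (fun _ hp => hp.1)
      (isSubmanifold_torusSphere (by omega)) (isSubmanifold_toricFiber hc hc1)
      fun _ hp _ hv _ hw => dForm_betaForm_of_mem_tangentSpace_toricFiber hc hc1 hp hv hw⟩

theorem toricFiber_eq_zeroLevel_inter (k d : ℕ) (c : Fin d → ℝ) :
    toricFiber k d c 0 = zeroLevel (torusSphere k d) (betaForm k d) (firstAction k d) ∩
      reductionMap k d ⁻¹' stdFiber d c := by
  rw [zeroLevel_firstAction]
  ext p
  constructor
  · rintro ⟨hp, hw, hz⟩
    refine ⟨⟨hp, hw⟩, ?_, hz⟩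
    have h := hp.2
    simpa [hw, stdSphere, reductionMap] using h
  · rintro ⟨⟨hp, hw⟩, -, hz⟩
    exact ⟨hp, hw, hz⟩

theorem toricFiber_eq_momentMap_fiber {k d : ℕ} {c : Fin d → ℝ} (hc : ∀ j, 0 < c j) :
    toricFiber k d c 0 = {p ∈ torusSphere k d |
      momentMap (betaForm k d) (toricAction k d) p =
        Sum.elim (fun _ => 0) (fun j => Real.pi * c j ^ 2)} := by
  ext p
  refine and_congr_right fun hp => ?_
  have h1 (l) : ‖p.1 l‖ = 1 := hp.1 l
  have h (x : ℂ) (r : ℝ) (hr : 0 ≤ r) : ‖x‖ ^ 2 = r ^ 2 ↔ ‖x‖ = r :=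
    pow_left_inj₀ (norm_nonneg x) hr two_ne_zero
  rw [momentMap_toricAction]
  simp only [funext_iff, Sum.forall, Sum.elim_inl, Sum.elim_inr, h1, Pi.zero_apply, one_pow,
    mul_one, mul_right_inj' Real.pi_ne_zero, h _ _ (hc _).le]

/-! ### Transport of the contact notions along linear isomorphisms. -/

section Transport

variable {E F : Type*} [NormedAddCommGroup E] [NormedSpace ℝ E]
  [NormedAddCommGroup F] [NormedSpace ℝ F]

theorem IsSubmanifold.image {n : ℕ} {X : Set E} (h : IsSubmanifold n X) (e : E ≃L[ℝ] F) :
    IsSubmanifold n (e '' X) := by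
  obtain ⟨m, hm, h⟩ := h
  refine isSubmanifold_of_local_zeroSet (ι := Fin m)
    (by rw [← e.toLinearEquiv.finrank_eq, ← hm, Fintype.card_fin]) ?_
  rintro _ ⟨p, hp, rfl⟩
  obtain ⟨U, hU, hpU, g, hg, hs, hX⟩ := h p hp
  refine ⟨e.symm ⁻¹' U, hU.preimage e.symm.continuous, by simpa using hpU,
    fun x => g (e.symm x), hg.comp e.symm.contDiff.contDiffOn fun x hx => hx,
    fun q hq => ?_, fun q hq => ?_⟩
  · have hd : DifferentiableAt ℝ g (e.symm q) :=
      (hg.contDiffAt (hU.mem_nhds hq)).differentiableAt (by simp)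
    have : HasFDerivAt (fun x => g (e.symm x))
        ((fderiv ℝ g (e.symm q)).comp (e.symm : F →L[ℝ] E)) q :=
      hd.hasFDerivAt.comp q e.symm.hasFDerivAt
    rw [this.fderiv]
    exact (hs _ hq).comp e.symm.surjective
  · have h1 : q ∈ e '' X ↔ e.symm q ∈ X :=
      ⟨by rintro ⟨x, hx, rfl⟩; simpa using hx, fun h => ⟨_, h, by simp⟩⟩
    rw [h1]
    exact ⟨fun h => (hX.subset ⟨h, hq⟩).2, fun h => (hX.superset ⟨hq, h⟩).1⟩

theorem image_mem_tangentSpace_image_iff (e : E ≃L[ℝ] F) {X : Set E} {p v : E} :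
    e v ∈ tangentSpace (e '' X) (e p) ↔ v ∈ tangentSpace X p := by
  constructor
  · intro h
    have := mem_tangentSpace_of_mapsTo (Y := X) e.symm.hasFDerivAt.hasFDerivWithinAt
      (by rintro _ ⟨x, hx, rfl⟩; simpa using hx) h
    simpa using this
  · exact mem_tangentSpace_of_mapsTo e.hasFDerivAt.hasFDerivWithinAt (Set.mapsTo_image e X)

variable {e : E ≃L[ℝ] F} {V : Set E} {α : E → E →L[ℝ] ℝ} {α' : F → F →L[ℝ] ℝ}

theorem dForm_image (hα : Differentiable ℝ α) (hα' : Differentiable ℝ α')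
    (h : ∀ p v, α' (e p) (e v) = α p v) (p v w : E) :
    dForm α' (e p) (e v) (e w) = dForm α p v w := by
  have key (v w : E) : fderiv ℝ α' (e p) (e v) (e w) = fderiv ℝ α p v w := by
    apply fderiv_form_apply_eq_of_hasDerivAt (hα' _)
    have h1 (t : ℝ) : α' (e p + t • e v) (e w) = α (p + t • v) w := by
      rw [← h, map_add, map_smul]
    simp only [h1]
    have h2 : HasDerivAt (fun t : ℝ => p + t • v) v 0 := by
      simpa using ((hasDerivAt_id (0 : ℝ)).smul_const v).const_add p
    have h3 : HasFDerivAt (fun q => α q w) ((fderiv ℝ α p).flip w) (p + (0 : ℝ) • v) := by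
      have := (hα p).hasFDerivAt.clm_apply (hasFDerivAt_const w p)
      simpa using this
    simpa [Function.comp_def] using h3.comp_hasDerivAt (0 : ℝ) h2
  rw [dForm_eq (hα' _), dForm_eq (hα _), key, key]

theorem IsContactForm.image (hα' : ContDiff ℝ ∞ α') (h : ∀ p v, α' (e p) (e v) = α p v)
    (hV : IsContactForm V α) : IsContactForm (e '' V) α' := by
  refine ⟨hα', ?_⟩
  rintro _ ⟨p, hp, rfl⟩
  obtain ⟨⟨v, hv, hv0⟩, hn⟩ := hV.2 p hp
  have hd := dForm_image (hV.1.differentiable (by simp)) (hα'.differentiable (by simp)) h p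
  refine ⟨⟨e v, (image_mem_tangentSpace_image_iff e).2 hv, by rwa [h]⟩, ?_⟩
  intro w hw hw0 hω
  obtain ⟨w, rfl⟩ := e.surjective w
  rw [image_mem_tangentSpace_image_iff] at hw
  rw [h] at hw0
  rw [hn w hw hw0 fun u hu hu0 => ?_, map_zero]
  rw [← hd]
  exact hω _ ((image_mem_tangentSpace_image_iff e).2 hu) (by rwa [h])

theorem IsDiffeo.image {f : E → E} (hf : IsDiffeo V V f) (e : E ≃L[ℝ] F) :
    IsDiffeo (e '' V) (e '' V) fun y => e (f (e.symm y)) := by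
  have hs : Set.MapsTo e.symm (e '' V) V := by rintro _ ⟨x, hx, rfl⟩; simpa using hx
  obtain ⟨h1, h2, g, h3, h4, h5, h6⟩ := hf
  refine ⟨e.contDiff.comp_contDiffOn (h1.comp e.symm.contDiff.contDiffOn hs),
    fun y hy => Set.mem_image_of_mem e (h2 (hs hy)), fun y => e (g (e.symm y)),
    e.contDiff.comp_contDiffOn (h3.comp e.symm.contDiff.contDiffOn hs),
    fun y hy => Set.mem_image_of_mem e (h4 (hs hy)), fun y hy => ?_, fun y hy => ?_⟩
  · simp [h5 (hs hy)]
  · simp [h6 (hs hy)]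

theorem IsContactomorphism.image {f : E → E} (h : ∀ p v, α' (e p) (e v) = α p v)
    (hf : IsContactomorphism V α f) :
    IsContactomorphism (e '' V) α' fun y => e (f (e.symm y)) := by
  refine ⟨hf.1.image e, ?_⟩
  rintro _ ⟨p, hp, rfl⟩ v hv
  obtain ⟨v, rfl⟩ := e.surjective v
  have hv' := (image_mem_tangentSpace_image_iff e).1 hv
  have hs : Set.MapsTo e.symm (e '' V) V := by rintro _ ⟨x, hx, rfl⟩; simpa using hx
  have hd : HasFDerivWithinAt f (fderivWithin ℝ f V p) V (e.symm (e p)) := by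
    rw [e.symm_apply_apply]
    exact (hf.1.1.contDiffWithinAt hp).differentiableWithinAt (by simp) |>.hasFDerivWithinAt
  have hd' := e.hasFDerivAt.comp_hasFDerivWithinAt (e p)
    (hd.comp (e p) e.symm.hasFDerivAt.hasFDerivWithinAt hs)
  rw [fderivWithin_of_mem_tangentSpace (f := fun y => e (f (e.symm y))) hd' hv]
  simpa [h] using hf.2 p hp v hv'

theorem IsDisplaceable.image {L : Set E} (h : ∀ p v, α' (e p) (e v) = α p v)
    (hL : IsDisplaceable V α L) : IsDisplaceable (e '' V) α' (e '' L) := by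
  obtain ⟨φ, ⟨h1, h2, h3⟩, h4⟩ := hL
  have hs : Set.MapsTo e.symm (e '' V) V := by rintro _ ⟨x, hx, rfl⟩; simpa using hx
  refine ⟨fun t y => e (φ t (e.symm y)), ⟨?_, ?_, fun t ht => (h3 t ht).image h⟩, ?_⟩
  · refine e.contDiff.comp_contDiffOn (h1.comp
      (contDiff_fst.prodMk (e.symm.contDiff.comp contDiff_snd)).contDiffOn ?_)
    rintro ⟨t, y⟩ ⟨ht, hy⟩
    exact ⟨ht, hs hy⟩
  · rintro _ ⟨p, hp, rfl⟩
    simp [h2 p hp]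
  · rw [Set.image_image]
    simp only [ContinuousLinearEquiv.symm_apply_apply]
    rw [← Set.image_image e, ← Set.image_inter e.injective, h4, Set.image_empty]

end Transport

/-! ### The standard sphere as the case `k = 0`. -/

/-- The identification of `ℂ^0 × ℂ^d × ℝ^0` with `ℂ^d`. -/
noncomputable def ambientZeroEquiv (d : ℕ) : Ambient 0 d ≃L[ℝ] (Fin d → ℂ) :=
  LinearEquiv.toContinuousLinearEquiv
    { toFun p := p.2.1
      invFun := fun z => (0, z, 0)
      map_add' := fun _ _ => rfl
      map_smul' := fun _ _ => rfl
      left_inv := fun _ => Prod.ext (Subsingleton.elim _ _) (Prod.ext rfl (Subsingleton.elim _ _))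
      right_inv := fun _ => rfl }

theorem ambientZeroEquiv_apply (d : ℕ) (p : Ambient 0 d) : ambientZeroEquiv d p = p.2.1 := rfl

theorem stdForm_ambientZeroEquiv (d : ℕ) (p v : Ambient 0 d) :
    stdForm d (ambientZeroEquiv d p) (ambientZeroEquiv d v) = betaForm 0 d p v := by
  simp [stdForm_apply, betaForm_apply, ambientZeroEquiv_apply]

theorem image_torusSphere_zero (d : ℕ) :
    ambientZeroEquiv d '' torusSphere 0 d = stdSphere d := by
  refine Set.Subset.antisymm ?_ fun z (hz : ∑ j, ‖z j‖ ^ 2 = 1) =>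
    ⟨(0, z, 0), ⟨fun l => l.elim0, by simpa using hz⟩, rfl⟩
  rintro _ ⟨p, hp, rfl⟩
  have := hp.2
  simpa [stdSphere, ambientZeroEquiv_apply] using this

theorem image_toricFiber_zero (d : ℕ) (c : Fin d → ℝ) :
    ambientZeroEquiv d '' toricFiber 0 d c 0 = stdFiber d c := by
  rw [stdFiber, ← image_torusSphere_zero]
  refine Set.Subset.antisymm ?_ ?_
  · rintro _ ⟨p, ⟨hp, -, hz⟩, rfl⟩
    exact ⟨⟨p, hp, rfl⟩, hz⟩
  · rintro _ ⟨⟨p, hp, rfl⟩, hz⟩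
    exact ⟨p, ⟨hp, Subsingleton.elim _ _, hz⟩, rfl⟩

theorem isInvariantTorusAction_stdAction (d : ℕ) :
    IsInvariantTorusAction (stdSphere d) (stdForm d) (stdAction d) where
  mapsTo s hs z hz := by
    have hs' (j) : ‖s j‖ = 1 := hs j
    have hz' : ∑ j, ‖z j‖ ^ 2 = 1 := hz
    simpa [stdAction, stdSphere, hs'] using hz'
  one z _ := by simp [stdAction]
  mul s _ t _ z _ := by simp [stdAction, mul_assoc]
  smooth := by
    unfold stdAction
    exact (contDiff_fst.mul contDiff_snd).contDiffOn
  invariant s hs z _ v hv := by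
    have hs' (j) : ‖s j‖ = 1 := hs j
    rw [fderivWithin_of_mem_tangentSpace (f := stdAction d s)
      (ContinuousLinearMap.mul ℝ (Fin d → ℂ) s).hasFDerivAt.hasFDerivWithinAt hv]
    simp [stdForm_apply, stdAction, angularForm_mul_mul, hs']

theorem isSubmanifold_stdSphere {d : ℕ} (hd : 0 < d) :
    IsSubmanifold (2 * d - 1) (stdSphere d) := by
  rw [← image_torusSphere_zero]
  exact (isSubmanifold_torusSphere (by omega)).image _

theorem isToricContact_stdSphere {d : ℕ} (hd : 0 < d) :
    IsToricContact (stdSphere d) (stdForm d) (stdAction d) where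
  submanifold := ⟨2 * d - 1, by simp; omega, isSubmanifold_stdSphere hd⟩
  contact := by
    rw [← image_torusSphere_zero]
    exact (isContactForm_betaForm 0 d).image (contDiff_stdForm d) (stdForm_ambientZeroEquiv d)
  action := isInvariantTorusAction_stdAction d
  effective s hs h := by
    ext j
    have key := h (Pi.single j 1) (by
      change ∑ i, ‖(Pi.single j 1 : Fin d → ℂ) i‖ ^ 2 = 1
      rw [Finset.sum_eq_single j (fun b _ hb => by simp [hb]) (by simp)]
      simp)
    simpa [stdAction] using congrFun key j

theorem isPreLagrangianToricFiber_stdFiber {d : ℕ} (hd : 0 < d) {c : Fin d → ℝ}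
    (hc : ∀ j, 0 < c j) (hc1 : ∑ j, c j ^ 2 = 1) :
    IsPreLagrangianToricFiber (stdSphere d) (stdForm d) (stdAction d) (stdFiber d c) := by
  have hdα : Differentiable ℝ (stdForm d) := (contDiff_stdForm d).differentiable (by simp)
  refine ⟨⟨fun j => c j, by simpa [stdSphere] using hc1, ?_⟩,
    isPreLagrangian_of_isotropic (n := d) (m := 2 * d - 1) (by omega) hdα (fun _ hp => hp.1)
      (isSubmanifold_stdSphere hd) ?_ ?_⟩
  · rw [← image_toricFiber_zero, (toricFiber_eq_orbit hc hc1).2, Set.image_image]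
    refine Set.Subset.antisymm ?_ ?_
    · rintro _ ⟨s, hs, rfl⟩
      exact ⟨fun j => s (Sum.inr j), fun j => hs (Sum.inr j), rfl⟩
    · rintro _ ⟨s, hs, rfl⟩
      exact ⟨Sum.elim 1 s, Sum.forall.2 ⟨fun l => l.elim0, hs⟩, rfl⟩
  · rw [← image_toricFiber_zero]
    simpa using (isSubmanifold_toricFiber hc hc1).image (ambientZeroEquiv d)
  · rw [← image_toricFiber_zero]
    rintro _ ⟨p, hp, rfl⟩ v hv w hw
    obtain ⟨v, rfl⟩ := (ambientZeroEquiv d).surjective v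
    obtain ⟨w, rfl⟩ := (ambientZeroEquiv d).surjective w
    rw [image_mem_tangentSpace_image_iff] at hv hw
    rw [dForm_image (differentiableAt_betaForm 0 d) hdα (stdForm_ambientZeroEquiv d)]
    exact dForm_betaForm_of_mem_tangentSpace_toricFiber hc hc1 hp hv hw

/-! ### Complex reflections of the null cone of `ℂ^{d,1}`. -/

section Rotation

variable {d : ℕ}

/-- The Euclidean norm on `ℂ^d`. -/
noncomputable def euclNorm (z : Fin d → ℂ) : ℝ := √(∑ j, ‖z j‖ ^ 2)

theorem euclNorm_nonneg (z : Fin d → ℂ) : 0 ≤ euclNorm z := Real.sqrt_nonneg _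

theorem euclNorm_sq (z : Fin d → ℂ) : euclNorm z ^ 2 = ∑ j, ‖z j‖ ^ 2 :=
  Real.sq_sqrt (Finset.sum_nonneg fun _ _ => sq_nonneg _)

theorem euclNorm_pos {z : Fin d → ℂ} (hz : z ≠ 0) : 0 < euclNorm z := by
  obtain ⟨j, hj⟩ := Function.ne_iff.1 hz
  refine Real.sqrt_pos.2 (Finset.sum_pos' (fun _ _ => sq_nonneg _) ⟨j, Finset.mem_univ j, ?_⟩)
  have := norm_pos_iff.2 hj
  positivity

theorem norm_sq_le_euclNorm_sq (z : Fin d → ℂ) (j : Fin d) : ‖z j‖ ^ 2 ≤ euclNorm z ^ 2 := by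
  rw [euclNorm_sq]
  exact Finset.single_le_sum (f := fun j => ‖z j‖ ^ 2) (fun _ _ => sq_nonneg _) (Finset.mem_univ j)

theorem euclNorm_smul (c : ℂ) (z : Fin d → ℂ) : euclNorm (c • z) = ‖c‖ * euclNorm z := by
  have h : ∑ j, ‖(c • z) j‖ ^ 2 = ‖c‖ ^ 2 * ∑ j, ‖z j‖ ^ 2 := by simp [mul_pow, Finset.mul_sum]
  rw [euclNorm, h, Real.sqrt_mul (sq_nonneg _), Real.sqrt_sq (norm_nonneg c), euclNorm]

/-- Minus the pairing of the null vector `(z, ‖z‖)` of `ℂ^{d,1}` with the negative vector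
`(b e_j, a)`. -/
noncomputable def negPairing (a b : ℝ) (j : Fin d) (z : Fin d → ℂ) : ℂ :=
  a * euclNorm z - b * z j

/-- The first component of the image of `(z, ‖z‖)` under the complex reflection of `ℂ^{d,1}` that
multiplies `(b e_j, a)` by `e`. -/
noncomputable def reflectFst (a b : ℝ) (j : Fin d) (e : ℂ) (z : Fin d → ℂ) : Fin d → ℂ :=
  z + Pi.single j ((e - 1) * negPairing a b j z * b)

/-- The second component of the image of `(z, ‖z‖)` under the complex reflection of `ℂ^{d,1}` that
multiplies `(b e_j, a)` by `e`. -/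
noncomputable def reflectSnd (a b : ℝ) (j : Fin d) (e : ℂ) (z : Fin d → ℂ) : ℂ :=
  euclNorm z + (e - 1) * negPairing a b j z * a

/-- The phase by which the image of `(z, ‖z‖)` is multiplied to make its second component
positive. -/
noncomputable def reflectPhase (a b : ℝ) (j : Fin d) (e : ℂ) (z : Fin d → ℂ) : ℂ :=
  (‖reflectSnd a b j e z‖⁻¹ : ℝ) * conj (reflectSnd a b j e z)

/-- The homogeneous map of `ℂ^d ∖ 0` induced by a complex reflection of the null cone of
`ℂ^{d,1}`. -/
noncomputable def reflect (a b : ℝ) (j : Fin d) (e : ℂ) (z : Fin d → ℂ) : Fin d → ℂ :=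
  reflectPhase a b j e z • reflectFst a b j e z

variable {a b : ℝ} {j : Fin d} {e : ℂ} {z : Fin d → ℂ}

/-- A nonzero null vector is never orthogonal to a negative vector: otherwise `a²‖z‖² = b²|z_j|² ≤
b²‖z‖²`, against `a² = 1 + b²`. -/
theorem negPairing_ne_zero (hab : a ^ 2 = 1 + b ^ 2) (hz : z ≠ 0) : negPairing a b j z ≠ 0 := by
  intro h
  have h1 : ((a * euclNorm z : ℝ) : ℂ) = b * z j := by
    rw [negPairing, sub_eq_zero] at h
    rw [← h]
    push_cast
    rfl
  have h2 := congrArg (fun x => ‖x‖ ^ 2) h1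
  simp only [Complex.norm_real, norm_mul, mul_pow, Real.norm_eq_abs, sq_abs] at h2
  have h3 := norm_sq_le_euclNorm_sq z j
  have h4 := euclNorm_pos hz
  have h5 := mul_le_mul_of_nonneg_left h3 (sq_nonneg b)
  nlinarith [pow_pos h4 2]

/-- `(b e_j, a)` is an eigenvector of the reflection with eigenvalue `e`, so the pairing with it is
multiplied by `e`; the normalization `a² - b² = 1` enters here. -/
theorem reflectSnd_sub_reflectFst (hab : a ^ 2 = 1 + b ^ 2) :
    a * reflectSnd a b j e z - b * reflectFst a b j e z j = e * negPairing a b j z := by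
  have hab' : (a : ℂ) ^ 2 = 1 + b ^ 2 := by exact_mod_cast hab
  simp only [reflectSnd, reflectFst, Pi.add_apply, Pi.single_eq_same]
  have h : negPairing a b j z = a * euclNorm z - b * z j := rfl
  linear_combination (e - 1) * negPairing a b j z * hab' - h

theorem conj_mul_self_of_norm_eq_one (he : ‖e‖ = 1) : conj e * e = 1 := by
  rw [Complex.conj_mul', he]
  simp

/-- Invariance of the Hermitian form under the reflection, restricted to the two coordinates that
change and polarized. Primes stand for derivatives along a path on which `e` varies with velocity `i
s' e`; this variation produces the last term. With `s' = 0` and primed equal to unprimed variables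
it shows that the null cone is preserved; its imaginary part governs the pull-back of the contact
form. -/
theorem reflect_hermitian_identity (hab : a ^ 2 = 1 + b ^ 2) (he : ‖e‖ = 1) (r r' s' : ℝ)
    (x x' q q' : ℂ) (hq : q = a * r - b * x) (hq' : q' = a * r' - b * x') :
    conj (x + (e - 1) * q * b) * (x' + ((Complex.I * s' * e) * q + (e - 1) * q') * b) -
      conj (r + (e - 1) * q * a) * (r' + ((Complex.I * s' * e) * q + (e - 1) * q') * a) =
    conj x * x' - r * r' - Complex.I * s' * (conj q * q) := by
  have hab' : (a : ℂ) ^ 2 = 1 + b ^ 2 := by exact_mod_cast hab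
  have he' := conj_mul_self_of_norm_eq_one he
  have hqc : conj q = a * r - b * conj x := by simp [hq]
  simp only [map_add, map_mul, map_sub, map_one, Complex.conj_ofReal]
  linear_combination (-(conj e - 1) * conj q * ((Complex.I * s' * e) * q + (e - 1) * q')) * hab' -
    (q' * conj q + Complex.I * s' * conj q * q) * he' +
    ((Complex.I * s' * e) * q + (e - 1) * q') * hqc + (conj e - 1) * conj q * hq'

theorem sum_norm_sq_reflectFst (hab : a ^ 2 = 1 + b ^ 2) (he : ‖e‖ = 1) :
    ∑ i, ‖reflectFst a b j e z i‖ ^ 2 = ‖reflectSnd a b j e z‖ ^ 2 := by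
  have h1 := reflect_hermitian_identity hab he (euclNorm z) (euclNorm z) 0 (z j) (z j)
    (negPairing a b j z) (negPairing a b j z) rfl rfl
  simp only [Complex.ofReal_zero, mul_zero, zero_mul, zero_add, sub_zero] at h1
  have h2 : ‖reflectFst a b j e z j‖ ^ 2 - ‖reflectSnd a b j e z‖ ^ 2 =
      ‖z j‖ ^ 2 - euclNorm z ^ 2 := by
    have h3 : conj (reflectFst a b j e z j) * reflectFst a b j e z j -
        conj (reflectSnd a b j e z) * reflectSnd a b j e z =
        conj (z j) * z j - euclNorm z * euclNorm z := by
      simpa [reflectFst, reflectSnd] using h1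
    simp only [Complex.conj_mul'] at h3
    have h4 : ((‖reflectFst a b j e z j‖ ^ 2 - ‖reflectSnd a b j e z‖ ^ 2 : ℝ) : ℂ) =
        ((‖z j‖ ^ 2 - euclNorm z ^ 2 : ℝ) : ℂ) := by
      push_cast
      rw [h3]
      ring
    exact_mod_cast h4
  rw [euclNorm_sq] at h2
  have h5 (y : Fin d → ℂ) : ∑ i, ‖y i‖ ^ 2 = ‖y j‖ ^ 2 + ∑ i ∈ Finset.univ.erase j, ‖y i‖ ^ 2 :=
    (Finset.add_sum_erase _ (fun i => ‖y i‖ ^ 2) (Finset.mem_univ j)).symm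
  rw [h5] at h2 ⊢
  have h6 : ∑ i ∈ Finset.univ.erase j, ‖reflectFst a b j e z i‖ ^ 2 =
      ∑ i ∈ Finset.univ.erase j, ‖z i‖ ^ 2 :=
    Finset.sum_congr rfl fun i hi => by simp [reflectFst, Finset.ne_of_mem_erase hi]
  linarith

/-- A null vector with zero last coordinate is zero, but the image of `(z, ‖z‖)` has the nonzero
pairing `e q` with the negative vector. -/
theorem reflectSnd_ne_zero (hab : a ^ 2 = 1 + b ^ 2) (he : ‖e‖ = 1) (hz : z ≠ 0) :
    reflectSnd a b j e z ≠ 0 := by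
  intro h
  have h1 := sum_norm_sq_reflectFst (j := j) (z := z) hab he
  rw [h, norm_zero, zero_pow two_ne_zero,
    Finset.sum_eq_zero_iff_of_nonneg fun _ _ => sq_nonneg _] at h1
  have h2 : reflectFst a b j e z j = 0 := by simpa using h1 j (Finset.mem_univ j)
  have h3 := reflectSnd_sub_reflectFst (j := j) (e := e) (z := z) hab
  rw [h, h2] at h3
  have he0 : e ≠ 0 := by rintro rfl; simp at he
  simp [he0, negPairing_ne_zero hab hz] at h3

theorem norm_reflectPhase (h : reflectSnd a b j e z ≠ 0) : ‖reflectPhase a b j e z‖ = 1 := by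
  simp [reflectPhase, h]

theorem reflectPhase_mul_reflectSnd (h : reflectSnd a b j e z ≠ 0) :
    reflectPhase a b j e z * reflectSnd a b j e z = ‖reflectSnd a b j e z‖ := by
  have h1 : (‖reflectSnd a b j e z‖ : ℂ) ≠ 0 := by simpa using h
  rw [reflectPhase, mul_assoc, Complex.conj_mul']
  push_cast
  field_simp

theorem euclNorm_reflect (hab : a ^ 2 = 1 + b ^ 2) (he : ‖e‖ = 1) (hz : z ≠ 0) :
    euclNorm (reflect a b j e z) = ‖reflectSnd a b j e z‖ := by
  rw [reflect, euclNorm_smul, norm_reflectPhase (reflectSnd_ne_zero hab he hz), one_mul, euclNorm,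
    sum_norm_sq_reflectFst hab he, Real.sqrt_sq (norm_nonneg _)]

theorem reflect_ne_zero (hab : a ^ 2 = 1 + b ^ 2) (he : ‖e‖ = 1) (hz : z ≠ 0) :
    reflect a b j e z ≠ 0 := by
  intro h
  have h1 := euclNorm_reflect (j := j) hab he hz
  rw [h] at h1
  exact reflectSnd_ne_zero (j := j) hab he hz (by simpa [euclNorm] using h1.symm)

theorem negPairing_reflect (hab : a ^ 2 = 1 + b ^ 2) (he : ‖e‖ = 1) (hz : z ≠ 0) :
    negPairing a b j (reflect a b j e z) =
      reflectPhase a b j e z * (e * negPairing a b j z) := by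
  rw [negPairing, euclNorm_reflect hab he hz, ← reflectSnd_sub_reflectFst hab,
    ← reflectPhase_mul_reflectSnd (reflectSnd_ne_zero hab he hz)]
  simp only [reflect, Pi.smul_apply, smul_eq_mul]
  ring

theorem norm_negPairing_reflect (hab : a ^ 2 = 1 + b ^ 2) (he : ‖e‖ = 1) (hz : z ≠ 0) :
    ‖negPairing a b j (reflect a b j e z)‖ = ‖negPairing a b j z‖ := by
  rw [negPairing_reflect hab he hz, norm_mul, norm_mul, he,
    norm_reflectPhase (reflectSnd_ne_zero hab he hz), one_mul, one_mul]

/-- The inverse reflection returns `(z, ‖z‖)` up to the phase `c` introduced by the first step, and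
the second normalization of the last coordinate removes `c`. -/
theorem reflect_reflect (hab : a ^ 2 = 1 + b ^ 2) {e' : ℂ} (he : ‖e‖ = 1) (hee : e' * e = 1)
    (hz : z ≠ 0) : reflect a b j e' (reflect a b j e z) = z := by
  have hs := reflectSnd_ne_zero (j := j) hab he hz
  set c := reflectPhase a b j e z with hc
  have hr : reflectSnd a b j e' (reflect a b j e z) = c * euclNorm z := by
    rw [reflectSnd, euclNorm_reflect hab he hz, negPairing_reflect hab he hz,
      ← reflectPhase_mul_reflectSnd hs, reflectSnd, ← hc]
    linear_combination c * negPairing a b j z * a * hee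
  have hf : reflectFst a b j e' (reflect a b j e z) = c • z := by
    rw [reflectFst, negPairing_reflect hab he hz, reflect, ← hc, reflectFst]
    ext i
    by_cases hi : i = j
    · subst hi
      simp only [Pi.add_apply, Pi.smul_apply, smul_eq_mul, Pi.single_eq_same]
      linear_combination c * negPairing a b i z * b * hee
    · simp [hi]
  have hc1 : ‖c‖ = 1 := norm_reflectPhase hs
  have hz' : (euclNorm z : ℂ) ≠ 0 := by exact_mod_cast (euclNorm_pos hz).ne'
  rw [reflect, reflectPhase, hr, hf, norm_mul, hc1, one_mul, Complex.norm_real,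
    Real.norm_of_nonneg (euclNorm_nonneg z), smul_smul, map_mul, Complex.conj_ofReal]
  have h : ((euclNorm z)⁻¹ : ℝ) * (conj c * euclNorm z) * c = (1 : ℂ) := by
    push_cast
    rw [show (euclNorm z : ℂ)⁻¹ * (conj c * euclNorm z) * c =
      ((euclNorm z : ℂ)⁻¹ * euclNorm z) * (conj c * c) by ring, inv_mul_cancel₀ hz', one_mul,
      conj_mul_self_of_norm_eq_one hc1]
  rw [h, one_smul]

theorem euclNorm_real_smul {t : ℝ} (ht : 0 < t) (z : Fin d → ℂ) :
    euclNorm (t • z) = t * euclNorm z := by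
  rw [← Complex.coe_smul, euclNorm_smul, Complex.norm_real, Real.norm_of_nonneg ht.le]

theorem negPairing_smul {t : ℝ} (ht : 0 < t) :
    negPairing a b j (t • z) = t * negPairing a b j z := by
  rw [negPairing, euclNorm_real_smul ht, negPairing]
  simp
  ring

theorem reflect_smul {t : ℝ} (ht : 0 < t) : reflect a b j e (t • z) = t • reflect a b j e z := by
  have h1 : reflectSnd a b j e (t • z) = t * reflectSnd a b j e z := by
    rw [reflectSnd, reflectSnd, negPairing_smul ht, euclNorm_real_smul ht]
    push_cast
    ring
  have h2 : reflectFst a b j e (t • z) = t • reflectFst a b j e z := by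
    rw [reflectFst, reflectFst, negPairing_smul ht, smul_add, ← Pi.single_smul]
    congr 2
    simp
    ring
  have h3 : reflectPhase a b j e (t • z) = reflectPhase a b j e z := by
    rw [reflectPhase, reflectPhase, h1, norm_mul, Complex.norm_real, Real.norm_of_nonneg ht.le,
      map_mul, Complex.conj_ofReal, mul_inv]
    have : (t : ℂ) ≠ 0 := by exact_mod_cast ht.ne'
    push_cast
    field_simp
  rw [reflect, reflect, h2, h3, smul_comm]

theorem reflect_one (hz : z ≠ 0) : reflect a b j 1 z = z := by
  have h1 : reflectSnd a b j 1 z = euclNorm z := by simp [reflectSnd]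
  have h2 : reflectFst a b j 1 z = z := by simp [reflectFst]
  have h3 : (euclNorm z : ℂ) ≠ 0 := by exact_mod_cast (euclNorm_pos hz).ne'
  rw [reflect, reflectPhase, h1, h2, Complex.norm_real, Real.norm_of_nonneg (euclNorm_nonneg z),
    Complex.conj_ofReal]
  push_cast
  rw [inv_mul_cancel₀ h3, one_smul]

theorem reflect_zero : reflect a b j e 0 = 0 := by
  simp [reflect, reflectFst, negPairing, euclNorm]

end Rotation

/-! ### Projection to the sphere along the weighted dilations. -/

section Normalize

variable {k d : ℕ}

/-- The factor by which `(z, w)` is rescaled to a point of the sphere, with `w` of weight two. -/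
noncomputable def sphereScale (p : Ambient k d) : ℝ :=
  √(2 / (∑ j, ‖p.2.1 j‖ ^ 2 + √((∑ j, ‖p.2.1 j‖ ^ 2) ^ 2 + 4 * ∑ l, p.2.2 l ^ 2)))

/-- The weighted dilation `(u, z, w) ↦ (u, tz, t²w)`. -/
noncomputable def dilate (t : ℝ) (p : Ambient k d) : Ambient k d := (p.1, t • p.2.1, t ^ 2 • p.2.2)

/-- The projection onto `T^k × S^{2d+k-1}` along the weighted dilations. -/
noncomputable def normalize (p : Ambient k d) : Ambient k d := dilate (sphereScale p) p

theorem dilate_dilate (s t : ℝ) (p : Ambient k d) : dilate s (dilate t p) = dilate (s * t) p := by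
  simp [dilate, smul_smul, mul_pow]

theorem dilate_one (p : Ambient k d) : dilate 1 p = p := by simp [dilate]

theorem sum_sq_pos_of_snd_ne_zero {p : Ambient k d} (hp : p.2 ≠ 0) :
    0 < (∑ j, ‖p.2.1 j‖ ^ 2) ^ 2 + 4 * ∑ l, p.2.2 l ^ 2 := by
  have h1 : 0 ≤ ∑ j, ‖p.2.1 j‖ ^ 2 := Finset.sum_nonneg fun _ _ => sq_nonneg _
  have h2 : 0 ≤ ∑ l, p.2.2 l ^ 2 := Finset.sum_nonneg fun _ _ => sq_nonneg _
  by_contra! h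
  have h3 : ∑ j, ‖p.2.1 j‖ ^ 2 = 0 := by nlinarith
  have h4 : ∑ l, p.2.2 l ^ 2 = 0 := by nlinarith
  rw [Finset.sum_eq_zero_iff_of_nonneg fun _ _ => sq_nonneg _] at h3 h4
  exact hp (Prod.ext (funext fun j => by simpa using h3 j (Finset.mem_univ j))
    (funext fun l => by simpa using h4 l (Finset.mem_univ l)))

theorem sphereScale_denom_pos {p : Ambient k d} (hp : p.2 ≠ 0) :
    0 < ∑ j, ‖p.2.1 j‖ ^ 2 + √((∑ j, ‖p.2.1 j‖ ^ 2) ^ 2 + 4 * ∑ l, p.2.2 l ^ 2) :=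
  add_pos_of_nonneg_of_pos (Finset.sum_nonneg fun _ _ => sq_nonneg _)
    (Real.sqrt_pos.2 (sum_sq_pos_of_snd_ne_zero hp))

theorem sphereScale_pos {p : Ambient k d} (hp : p.2 ≠ 0) : 0 < sphereScale p :=
  Real.sqrt_pos.2 (div_pos two_pos (sphereScale_denom_pos hp))

/-- With `A = ∑ |z_j|²` and `B = ∑ w_l²`, the square of the scale is the positive root of `A x + B
x² = 1`. The rationalized form `2 / (A + √(A² + 4B))` of this root stays valid and smooth when `B =
0`. -/
theorem normalize_mem_torusSphere {p : Ambient k d} (hu : p.1 ∈ torus (Fin k)) (hp : p.2 ≠ 0) :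
    normalize p ∈ torusSphere k d := by
  refine ⟨hu, ?_⟩
  have h1 := sphereScale_denom_pos hp
  have h2 := Real.sq_sqrt (sum_sq_pos_of_snd_ne_zero hp).le
  have h3 : sphereScale p ^ 2 = 2 /
      (∑ j, ‖p.2.1 j‖ ^ 2 + √((∑ j, ‖p.2.1 j‖ ^ 2) ^ 2 + 4 * ∑ l, p.2.2 l ^ 2)) :=
    Real.sq_sqrt (div_pos two_pos h1).le
  have h4 : ∑ j, ‖(normalize p).2.1 j‖ ^ 2 = sphereScale p ^ 2 * ∑ j, ‖p.2.1 j‖ ^ 2 := by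
    simp [normalize, dilate, mul_pow, Finset.mul_sum]
  have h5 : ∑ l, (normalize p).2.2 l ^ 2 = (sphereScale p ^ 2) ^ 2 * ∑ l, p.2.2 l ^ 2 := by
    simp [normalize, dilate, mul_pow, Finset.mul_sum]
  rw [h4, h5, h3]
  set A := ∑ j, ‖p.2.1 j‖ ^ 2
  set B := ∑ l, p.2.2 l ^ 2
  set R := √(A ^ 2 + 4 * B)
  field_simp
  linear_combination -h2

theorem sphereScale_dilate {t : ℝ} (ht : 0 < t) (p : Ambient k d) :
    sphereScale (dilate t p) = t⁻¹ * sphereScale p := by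
  have h1 : ∑ j, ‖(dilate t p).2.1 j‖ ^ 2 = t ^ 2 * ∑ j, ‖p.2.1 j‖ ^ 2 := by
    simp [dilate, mul_pow, Finset.mul_sum]
  have h2 : ∑ l, (dilate t p).2.2 l ^ 2 = t ^ 4 * ∑ l, p.2.2 l ^ 2 := by
    simp [dilate, mul_pow, Finset.mul_sum, ← pow_mul]
  rw [sphereScale, h1, h2, sphereScale]
  set A := ∑ j, ‖p.2.1 j‖ ^ 2
  set B := ∑ l, p.2.2 l ^ 2
  rw [show (t ^ 2 * A) ^ 2 + 4 * (t ^ 4 * B) = (t ^ 2) ^ 2 * (A ^ 2 + 4 * B) by ring,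
    Real.sqrt_mul (sq_nonneg _), Real.sqrt_sq (sq_nonneg _), ← mul_add,
    show 2 / (t ^ 2 * (A + √(A ^ 2 + 4 * B))) = (t⁻¹) ^ 2 * (2 / (A + √(A ^ 2 + 4 * B))) by
      rw [div_mul_eq_div_div, inv_pow]; ring,
    Real.sqrt_mul (sq_nonneg _), Real.sqrt_sq (inv_pos.2 ht).le]

theorem normalize_dilate {t : ℝ} (ht : 0 < t) (p : Ambient k d) :
    normalize (dilate t p) = normalize p := by
  rw [normalize, sphereScale_dilate ht, dilate_dilate, normalize]
  congr 1
  field_simp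

theorem normalize_of_mem {p : Ambient k d} (hp : p ∈ torusSphere k d) : normalize p = p := by
  have h0 := hp.2
  have hA : 0 ≤ ∑ j, ‖p.2.1 j‖ ^ 2 := Finset.sum_nonneg fun _ _ => sq_nonneg _
  have hB : 0 ≤ ∑ l, p.2.2 l ^ 2 := Finset.sum_nonneg fun _ _ => sq_nonneg _
  have h : sphereScale p = 1 := by
    rw [sphereScale]
    set A := ∑ j, ‖p.2.1 j‖ ^ 2
    set B := ∑ l, p.2.2 l ^ 2
    -- On the sphere `A + B = 1`, so the discriminant is a square, with `2 - A` nonnegative.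
    rw [show A ^ 2 + 4 * B = (2 - A) ^ 2 by linear_combination 4 * h0,
      Real.sqrt_sq (by linarith)]
    simp
  rw [normalize, h, dilate_one]

theorem contDiffAt_sphereScale {p : Ambient k d} (hp : p.2 ≠ 0) :
    ContDiffAt ℝ ∞ (sphereScale (k := k) (d := d)) p := by
  have h1 : ContDiff ℝ ∞ fun p : Ambient k d => ∑ j, ‖p.2.1 j‖ ^ 2 :=
    ContDiff.sum fun j _ =>
      (show ContDiff ℝ ∞ fun p : Ambient k d => p.2.1 j by fun_prop).norm_sq ℝ
  have h2 : ContDiff ℝ ∞ fun p : Ambient k d =>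
      (∑ j, ‖p.2.1 j‖ ^ 2) ^ 2 + 4 * ∑ l, p.2.2 l ^ 2 :=
    (h1.pow 2).add (contDiff_const.mul (ContDiff.sum fun l _ => by fun_prop))
  have h3 := sphereScale_denom_pos hp
  exact (contDiffAt_const.div (h1.contDiffAt.add (h2.contDiffAt.sqrt
    (sum_sq_pos_of_snd_ne_zero hp).ne')) h3.ne').sqrt (div_pos two_pos h3).ne'

end Normalize

/-! ### The cut-off flow on `T^k × S^{2d+k-1}`. -/

/-- The data of a cut-off lift to `T^k × S^{2d+k-1}` of the rotation of `S^{2d-1}` about an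
interior point of the ball. -/
structure RotationData (d : ℕ) where
  a : ℝ
  b : ℝ
  j : Fin d
  h : ℝ → ℝ
  m : ℝ → ℝ
  sq_eq : a ^ 2 = 1 + b ^ 2
  contDiff_h : ContDiff ℝ ∞ h
  contDiff_m : ContDiff ℝ ∞ m
  deriv_eq : ∀ x, deriv m x + h x / 2 + x * deriv h x = 0
  h_eq_zero : ∀ x, 1 ≤ x → h x = 0
  m_eq_zero : ∀ x, 1 ≤ x → m x = 0
  m_zero : m 0 = 1

namespace RotationData

variable {k d : ℕ} (D : RotationData d)

/-- The dilation-invariant quotient of `w` by the Hamiltonian of the rotation. -/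
noncomputable def slope (p : Ambient k d) : Fin k → ℝ :=
  (‖negPairing D.a D.b D.j p.2.1‖ ^ 2)⁻¹ • p.2.2

/-- The squared length of the slope. -/
noncomputable def slopeSq (p : Ambient k d) : ℝ := ∑ l, D.slope p l ^ 2

/-- The translation of the torus coordinates at time `t`. -/
noncomputable def shift (t : ℝ) (p : Ambient k d) : Fin k → ℝ :=
  (-(Real.pi ^ 2 * t * D.h (D.slopeSq p))) • D.slope p

/-- The angle of rotation at time `t`. -/
noncomputable def angle (t : ℝ) (p : Ambient k d) : ℝ := Real.pi * t * D.m (D.slopeSq p)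

/-- The homogeneous flow. -/
noncomputable def flow (t : ℝ) (p : Ambient k d) : Ambient k d :=
  (fun l => p.1 l * Complex.exp (D.shift t p l * Complex.I),
    reflect D.a D.b D.j (Complex.exp (D.angle t p * Complex.I)) p.2.1, p.2.2)

/-- The contact flow on `T^k × S^{2d+k-1}`. -/
noncomputable def contactFlow (t : ℝ) (p : Ambient k d) : Ambient k d := normalize (D.flow t p)

/-- Both `|q|²` and `w` have weight two, so their quotient is invariant. This makes the flow commute
with the dilations and descend to the sphere. -/
theorem slope_dilate {t : ℝ} (ht : 0 < t) (p : Ambient k d) :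
    D.slope (dilate t p) = D.slope p := by
  simp only [slope, dilate, negPairing_smul ht, norm_mul, Complex.norm_real,
    Real.norm_of_nonneg ht.le, smul_smul]
  congr 1
  field_simp

theorem flow_dilate {s : ℝ} (hs : 0 < s) (t : ℝ) (p : Ambient k d) :
    D.flow t (dilate s p) = dilate s (D.flow t p) := by
  simp only [flow, shift, angle, slopeSq, D.slope_dilate hs]
  simp only [dilate, reflect_smul hs]

theorem flow_eq_self {t : ℝ} {p : Ambient k d} (h : p.2.1 = 0 ∨ 1 ≤ D.slopeSq p) :
    D.flow t p = p := by
  by_cases hz : p.2.1 = 0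
  · have h1 : D.slope p = 0 := by simp [slope, hz, negPairing, euclNorm]
    refine Prod.ext (funext fun l => ?_) (Prod.ext ?_ rfl)
    · simp [flow, shift, h1]
    · simp [flow, hz, reflect_zero]
  · replace h := h.resolve_left hz
    refine Prod.ext (funext fun l => ?_) (Prod.ext ?_ rfl)
    · simp [flow, shift, D.h_eq_zero _ h]
    · simp [flow, angle, D.m_eq_zero _ h, reflect_one hz]

/-- The rotation conserves `|q|` and the flow leaves `w` alone. The angle and the translation are
thus constant along each trajectory, which is why reversing time inverts the flow. -/
theorem slope_flow (t : ℝ) (p : Ambient k d) : D.slope (D.flow t p) = D.slope p := by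
  by_cases hz : p.2.1 = 0
  · rw [D.flow_eq_self (Or.inl hz)]
  · simp only [slope, flow]
    rw [norm_negPairing_reflect D.sq_eq (Complex.norm_exp_ofReal_mul_I _) hz]

theorem flow_neg_flow (t : ℝ) (p : Ambient k d) : D.flow (-t) (D.flow t p) = p := by
  by_cases hz : p.2.1 = 0
  · rw [D.flow_eq_self (p := p) (Or.inl hz), D.flow_eq_self (Or.inl hz)]
  · have h1 : D.shift (-t) (D.flow t p) = -D.shift t p := by
      simp [shift, slopeSq, slope_flow]
    have h2 : D.angle (-t) (D.flow t p) = -D.angle t p := by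
      simp [angle, slopeSq, slope_flow]
    refine Prod.ext (funext fun l => ?_) (Prod.ext ?_ rfl)
    · simp only [flow] at h1 ⊢
      rw [h1, mul_assoc, ← Complex.exp_add]
      simp
    · rw [flow, h2]
      refine reflect_reflect D.sq_eq (Complex.norm_exp_ofReal_mul_I _) ?_ hz
      rw [← Complex.exp_add]
      simp

theorem flow_snd_ne_zero {t : ℝ} {p : Ambient k d} (hp : p.2 ≠ 0) : (D.flow t p).2 ≠ 0 := by
  by_cases hz : p.2.1 = 0
  · rwa [D.flow_eq_self (Or.inl hz)]
  · intro h
    exact reflect_ne_zero D.sq_eq (Complex.norm_exp_ofReal_mul_I _) hz (congrArg Prod.fst h)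

theorem contactFlow_mem {t : ℝ} {p : Ambient k d} (hp : p ∈ torusSphere k d) :
    D.contactFlow t p ∈ torusSphere k d := by
  refine normalize_mem_torusSphere (fun l => ?_)
    (D.flow_snd_ne_zero (snd_ne_zero_of_mem_torusSphere hp))
  simp only [flow]
  rw [norm_mul, Complex.norm_exp_ofReal_mul_I, hp.1 l, one_mul]

theorem contactFlow_neg_contactFlow (t : ℝ) {p : Ambient k d} (hp : p ∈ torusSphere k d) :
    D.contactFlow (-t) (D.contactFlow t p) = p := by
  have h := sphereScale_pos (D.flow_snd_ne_zero (t := t) (snd_ne_zero_of_mem_torusSphere hp))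
  rw [contactFlow, contactFlow, normalize.eq_1 (D.flow t p), D.flow_dilate h, normalize_dilate h,
    flow_neg_flow, normalize_of_mem hp]

theorem contactFlow_eq_self {t : ℝ} {p : Ambient k d} (hp : p ∈ torusSphere k d)
    (h : p.2.1 = 0 ∨ 1 ≤ D.slopeSq p) : D.contactFlow t p = p := by
  rw [contactFlow, D.flow_eq_self h, normalize_of_mem hp]

theorem contactFlow_zero {p : Ambient k d} (hp : p ∈ torusSphere k d) :
    D.contactFlow 0 p = p := by
  have h : D.flow 0 p = p := by
    by_cases hz : p.2.1 = 0
    · exact D.flow_eq_self (Or.inl hz)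
    · refine Prod.ext (funext fun l => ?_) (Prod.ext ?_ rfl)
      · simp [flow, shift]
      · simp [flow, angle, reflect_one hz]
  rw [contactFlow, h, normalize_of_mem hp]

/-- The flow is the identity near the points with `z = 0`. -/
theorem eventually_contactFlow_eq_self {p : Ambient k d} (hp : p ∈ torusSphere k d)
    (hz : p.2.1 = 0) :
    ∀ᶠ q in nhds p, q ∈ torusSphere k d → ∀ t, D.contactFlow t q = q := by
  have hcont : Continuous fun q : Ambient k d => negPairing D.a D.b D.j q.2.1 := by
    unfold negPairing euclNorm
    fun_prop
  have h1 : Continuous fun q : Ambient k d => ‖negPairing D.a D.b D.j q.2.1‖ ^ 4 := by fun_prop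
  have h2 : Continuous fun q : Ambient k d => ∑ l, q.2.2 l ^ 2 := by fun_prop
  -- The inequality `1 < |w|² / |q|⁴` with its denominator cleared: in this form it is continuous
  -- across `z = 0`, where `q` vanishes and `|w| = 1`.
  have h3 : ‖negPairing D.a D.b D.j p.2.1‖ ^ 4 < ∑ l, p.2.2 l ^ 2 := by
    have h := hp.2
    simp only [hz] at h
    simp [hz, negPairing, euclNorm] at h ⊢
    rw [h]
    exact one_pos
  filter_upwards [h1.continuousAt.eventually_lt h2.continuousAt h3] with q hq hqV t
  refine D.contactFlow_eq_self hqV ?_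
  by_cases hz : q.2.1 = 0
  · exact Or.inl hz
  · right
    have h4 := norm_pos_iff.2 (negPairing_ne_zero (j := D.j) D.sq_eq hz)
    have h5 : D.slopeSq q = (‖negPairing D.a D.b D.j q.2.1‖ ^ 4)⁻¹ * ∑ l, q.2.2 l ^ 2 := by
      simp only [slopeSq, slope, Pi.smul_apply, smul_eq_mul, mul_pow, ← Finset.mul_sum]
      congr 1
      rw [inv_pow, ← pow_mul]
    rw [h5, inv_mul_eq_div, one_le_div (by positivity)]
    exact hq.le

end RotationData

/-! ### First variation of the angular forms. -/

theorem angularForm_eq_im (u v : ℂ) : angularForm u v = (conj u * v).im := by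
  simp [angularForm]

theorem angularForm_mul_deriv (c c' y y' : ℂ) :
    angularForm (c * y) (c' * y + c * y') =
      ‖c‖ ^ 2 * angularForm y y' + ‖y‖ ^ 2 * angularForm c c' := by
  simp only [Complex.sq_norm, Complex.normSq_apply, angularForm_apply, Complex.mul_re,
    Complex.mul_im, Complex.add_re, Complex.add_im]
  ring

theorem angularForm_conj_deriv (x x' : ℝ) (y y' : ℂ) :
    angularForm (x * conj y) (x' * conj y + x * conj y') = -(x ^ 2 * angularForm y y') := by
  simp only [angularForm_apply, Complex.mul_re, Complex.mul_im, Complex.add_re, Complex.add_im,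
    Complex.conj_re, Complex.conj_im, Complex.ofReal_re, Complex.ofReal_im]
  ring

/-- The imaginary part of `reflect_hermitian_identity`, completed by the coordinates that the
reflection leaves fixed. The last coordinate `‖z‖` of the original null vector is real, so it
contributes nothing on the right. -/
theorem sum_angularForm_reflect {d : ℕ} {a b : ℝ} {j : Fin d} {e : ℂ} (hab : a ^ 2 = 1 + b ^ 2)
    (he : ‖e‖ = 1) (z ζ : Fin d → ℂ) (r' s' : ℝ) {q' : ℂ} (hq' : q' = a * r' - b * ζ j) :
    ∑ i, angularForm (reflectFst a b j e z i) ((ζ + Pi.single j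
        ((Complex.I * s' * e * negPairing a b j z + (e - 1) * q') * b) : Fin d → ℂ) i) -
      angularForm (reflectSnd a b j e z)
        (r' + (Complex.I * s' * e * negPairing a b j z + (e - 1) * q') * a) =
    ∑ i, angularForm (z i) (ζ i) - ‖negPairing a b j z‖ ^ 2 * s' := by
  have h1 := congrArg Complex.im (reflect_hermitian_identity hab he (euclNorm z) r' s' (z j) (ζ j)
    (negPairing a b j z) q' rfl hq')
  have h3 (y : Fin d → ℝ) : ∑ i, y i = y j + ∑ i ∈ Finset.univ.erase j, y i :=
    (Finset.add_sum_erase _ y (Finset.mem_univ j)).symm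
  have h4 : ∑ i ∈ Finset.univ.erase j, angularForm (reflectFst a b j e z i) ((ζ + Pi.single j
        ((Complex.I * s' * e * negPairing a b j z + (e - 1) * q') * b) : Fin d → ℂ) i) =
      ∑ i ∈ Finset.univ.erase j, angularForm (z i) (ζ i) :=
    Finset.sum_congr rfl fun i hi => by simp [reflectFst, Finset.ne_of_mem_erase hi]
  rw [h3, h4, h3 fun i => angularForm (z i) (ζ i)]
  have h5 : (Complex.I * s' * (conj (negPairing a b j z) * negPairing a b j z)).im =
      ‖negPairing a b j z‖ ^ 2 * s' := by
    rw [Complex.conj_mul', show Complex.I * s' * ((‖negPairing a b j z‖ : ℂ) ^ 2) =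
      ((‖negPairing a b j z‖ ^ 2 * s' : ℝ) : ℂ) * Complex.I by push_cast; ring]
    simp only [Complex.im_ofReal_mul, Complex.I_im, mul_one]
  have h6 : ((euclNorm z : ℂ) * r').im = 0 := by simp
  rw [Complex.sub_im, Complex.sub_im, Complex.sub_im, h5, h6, ← angularForm_eq_im,
    ← angularForm_eq_im, ← angularForm_eq_im] at h1
  simp only [Pi.add_apply, Pi.single_eq_same, reflectFst, reflectSnd]
  linarith

/-! ### Smoothness of the rotation and of the contact flow. -/

section Smooth

variable {d : ℕ}

theorem contDiffAt_euclNorm {z : Fin d → ℂ} (hz : z ≠ 0) :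
    ContDiffAt ℝ ∞ (euclNorm (d := d)) z := by
  have h1 : ContDiff ℝ ∞ fun z : Fin d → ℂ => ∑ j, ‖z j‖ ^ 2 :=
    ContDiff.sum fun j _ => (contDiff_apply ℝ ℂ j).norm_sq ℝ
  exact h1.contDiffAt.sqrt (by rw [← euclNorm_sq]; exact (pow_pos (euclNorm_pos hz) 2).ne')

theorem contDiffAt_negPairing (a b : ℝ) (j : Fin d) {z : Fin d → ℂ} (hz : z ≠ 0) :
    ContDiffAt ℝ ∞ (negPairing a b j) z := by
  have h1 : ContDiffAt ℝ ∞ (fun z : Fin d → ℂ => (euclNorm z : ℂ)) z :=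
    Complex.ofRealCLM.contDiff.contDiffAt.comp z (contDiffAt_euclNorm hz)
  have h2 : ContDiffAt ℝ ∞ (fun z : Fin d → ℂ => z j) z := (contDiff_apply ℝ ℂ j).contDiffAt
  exact (contDiffAt_const.mul h1).sub (contDiffAt_const.mul h2)

theorem contDiffAt_reflectSnd (a b : ℝ) (j : Fin d) {x : ℂ × (Fin d → ℂ)} (hz : x.2 ≠ 0) :
    ContDiffAt ℝ ∞ (fun x : ℂ × (Fin d → ℂ) => reflectSnd a b j x.1 x.2) x := by
  have h1 : ContDiffAt ℝ ∞ (fun x : ℂ × (Fin d → ℂ) => (euclNorm x.2 : ℂ)) x :=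
    Complex.ofRealCLM.contDiff.contDiffAt.comp x
      ((contDiffAt_euclNorm hz).comp x contDiffAt_snd)
  have h2 : ContDiffAt ℝ ∞ (fun x : ℂ × (Fin d → ℂ) => negPairing a b j x.2) x :=
    (contDiffAt_negPairing a b j hz).comp x contDiffAt_snd
  exact h1.add (((contDiffAt_fst.sub contDiffAt_const).mul h2).mul contDiffAt_const)

theorem contDiffAt_reflect {a b : ℝ} (hab : a ^ 2 = 1 + b ^ 2) (j : Fin d)
    {x : ℂ × (Fin d → ℂ)} (he : ‖x.1‖ = 1) (hz : x.2 ≠ 0) :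
    ContDiffAt ℝ ∞ (fun x : ℂ × (Fin d → ℂ) => reflect a b j x.1 x.2) x := by
  have h0 := contDiffAt_reflectSnd a b j hz
  have hne := reflectSnd_ne_zero (j := j) hab he hz
  have h1 : ContDiffAt ℝ ∞ (fun x : ℂ × (Fin d → ℂ) => negPairing a b j x.2) x :=
    (contDiffAt_negPairing a b j hz).comp x contDiffAt_snd
  have h2 : ContDiffAt ℝ ∞ (fun x : ℂ × (Fin d → ℂ) => reflectPhase a b j x.1 x.2) x :=
    (Complex.ofRealCLM.contDiff.contDiffAt.comp x
      ((h0.norm ℝ hne).inv (norm_ne_zero_iff.2 hne))).mul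
      (Complex.conjCLE.contDiff.contDiffAt.comp x h0)
  rw [contDiffAt_pi]
  intro i
  have h3 : ContDiffAt ℝ ∞ (fun x : ℂ × (Fin d → ℂ) => reflectFst a b j x.1 x.2 i) x := by
    have h4 : ContDiffAt ℝ ∞ (fun x : ℂ × (Fin d → ℂ) => x.2 i) x :=
      (show ContDiff ℝ ∞ fun x : ℂ × (Fin d → ℂ) => x.2 i by fun_prop).contDiffAt
    by_cases hi : i = j
    · subst hi
      simp only [reflectFst, Pi.add_apply, Pi.single_eq_same]
      exact h4.add (((contDiffAt_fst.sub contDiffAt_const).mul h1).mul contDiffAt_const)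
    · simpa [reflectFst, hi] using h4
  exact h2.mul h3

end Smooth

namespace RotationData

variable {k d : ℕ} (D : RotationData d)

theorem contDiffAt_slope {p : Ambient k d} (hz : p.2.1 ≠ 0) :
    ContDiffAt ℝ ∞ (D.slope (k := k)) p := by
  have h1 : ContDiffAt ℝ ∞ (fun p : Ambient k d => negPairing D.a D.b D.j p.2.1) p :=
    ContDiffAt.comp p (g := negPairing D.a D.b D.j) (f := fun p : Ambient k d => p.2.1)
      (contDiffAt_negPairing D.a D.b D.j hz)
      (show ContDiff ℝ ∞ fun p : Ambient k d => p.2.1 by fun_prop).contDiffAt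
  have h2 : ContDiffAt ℝ ∞ (fun p : Ambient k d => p.2.2) p :=
    (show ContDiff ℝ ∞ fun p : Ambient k d => p.2.2 by fun_prop).contDiffAt
  have h3 := norm_pos_iff.2 (negPairing_ne_zero (j := D.j) D.sq_eq hz)
  exact ((h1.norm_sq ℝ).inv (by positivity)).smul h2

theorem contDiffAt_slopeSq {p : Ambient k d} (hz : p.2.1 ≠ 0) :
    ContDiffAt ℝ ∞ (D.slopeSq (k := k)) p :=
  ContDiffAt.sum fun l _ => (contDiffAt_pi.1 (D.contDiffAt_slope hz) l).pow 2

theorem contDiffAt_shift {x : ℝ × Ambient k d} (hz : x.2.2.1 ≠ 0) :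
    ContDiffAt ℝ ∞ (fun x : ℝ × Ambient k d => D.shift x.1 x.2) x := by
  have h1 := (D.contDiffAt_slope hz).comp x contDiffAt_snd
  have h2 := D.contDiff_h.contDiffAt.comp x ((D.contDiffAt_slopeSq hz).comp x contDiffAt_snd)
  exact ((contDiffAt_const.mul contDiffAt_fst).mul h2).neg.smul h1

theorem contDiffAt_angle {x : ℝ × Ambient k d} (hz : x.2.2.1 ≠ 0) :
    ContDiffAt ℝ ∞ (fun x : ℝ × Ambient k d => D.angle x.1 x.2) x :=
  (contDiffAt_const.mul contDiffAt_fst).mul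
    (D.contDiff_m.contDiffAt.comp x ((D.contDiffAt_slopeSq hz).comp x contDiffAt_snd))

theorem contDiffAt_flow {x : ℝ × Ambient k d} (hz : x.2.2.1 ≠ 0) :
    ContDiffAt ℝ ∞ (fun x : ℝ × Ambient k d => D.flow x.1 x.2) x := by
  have hexp {f : ℝ × Ambient k d → ℝ} (hf : ContDiffAt ℝ ∞ f x) :
      ContDiffAt ℝ ∞ (fun x => Complex.exp (f x * Complex.I)) x :=
    ((Complex.ofRealCLM.contDiff.contDiffAt.comp x hf).mul contDiffAt_const).cexp
  refine ContDiffAt.prodMk ?_ (ContDiffAt.prodMk ?_ ?_)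
  · rw [contDiffAt_pi]
    intro l
    refine ContDiffAt.mul ?_ (hexp (contDiffAt_pi.1 (D.contDiffAt_shift hz) l))
    exact (show ContDiff ℝ ∞ fun x : ℝ × Ambient k d => x.2.1 l by fun_prop).contDiffAt
  · refine ContDiffAt.comp x (g := fun y : ℂ × (Fin d → ℂ) => reflect D.a D.b D.j y.1 y.2)
      (f := fun x : ℝ × Ambient k d => (Complex.exp (D.angle x.1 x.2 * Complex.I), x.2.2.1))
      (contDiffAt_reflect D.sq_eq D.j (Complex.norm_exp_ofReal_mul_I _) hz)
      ((hexp (D.contDiffAt_angle hz)).prodMk ?_)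
    exact (show ContDiff ℝ ∞ fun x : ℝ × Ambient k d => x.2.2.1 by fun_prop).contDiffAt
  · exact (show ContDiff ℝ ∞ fun x : ℝ × Ambient k d => x.2.2.2 by fun_prop).contDiffAt

theorem contDiffAt_contactFlow {x : ℝ × Ambient k d} (hz : x.2.2.1 ≠ 0) :
    ContDiffAt ℝ ∞ (fun x : ℝ × Ambient k d => D.contactFlow x.1 x.2) x := by
  have h1 := D.contDiffAt_flow hz
  have hne : (D.flow x.1 x.2).2 ≠ 0 := D.flow_snd_ne_zero fun h => hz (by rw [h]; rfl)
  have h2 : ContDiffAt ℝ ∞ (fun x : ℝ × Ambient k d => sphereScale (D.flow x.1 x.2)) x :=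
    ContDiffAt.comp x (g := sphereScale) (f := fun x : ℝ × Ambient k d => D.flow x.1 x.2)
      (contDiffAt_sphereScale hne) h1
  exact h1.fst.prodMk ((h2.smul h1.snd.fst).prodMk ((h2.pow 2).smul h1.snd.snd))

theorem contDiffOn_contactFlow (I : Set ℝ) :
    ContDiffOn ℝ ∞ (fun x : ℝ × Ambient k d => D.contactFlow x.1 x.2) (I ×ˢ torusSphere k d) := by
  rintro ⟨t, p⟩ ⟨ht, hp⟩
  -- At `z = 0` the formulas for the flow are not smooth, but the cut-off makes the flow the
  -- identity on a neighbourhood within the manifold.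
  by_cases hz : p.2.1 = 0
  · refine (contDiffWithinAt_snd (𝕜 := ℝ) (E := ℝ) (F := Ambient k d)).congr_of_eventuallyEq ?_
      (D.contactFlow_eq_self hp (Or.inl hz))
    rw [Filter.EventuallyEq, eventually_nhdsWithin_iff]
    have h1 : ∀ᶠ x : ℝ × Ambient k d in nhds (t, p),
        x.2 ∈ torusSphere k d → ∀ t, D.contactFlow t x.2 = x.2 :=
      continuousAt_snd.eventually (D.eventually_contactFlow_eq_self hp hz)
    filter_upwards [h1] with x hx hxV using hx hxV.2 x.1
  · exact (D.contDiffAt_contactFlow hz).contDiffWithinAt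

theorem isDiffeo_contactFlow (t : ℝ) :
    IsDiffeo (torusSphere k d) (torusSphere k d) (D.contactFlow t) := by
  have h (t : ℝ) : ContDiffOn ℝ ∞ (D.contactFlow (k := k) t) (torusSphere k d) :=
    (D.contDiffOn_contactFlow {t}).comp (f := fun p => (t, p))
      (contDiff_const.prodMk contDiff_id).contDiffOn fun p hp => ⟨rfl, hp⟩
  refine ⟨h t, fun p hp => D.contactFlow_mem hp, D.contactFlow (-t), h _,
    fun p hp => D.contactFlow_mem hp, fun p hp => D.contactFlow_neg_contactFlow t hp,
    fun p hp => ?_⟩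
  simpa using D.contactFlow_neg_contactFlow (-t) hp

end RotationData

/-! ### The flow preserves the contact structure. -/

theorem hasDerivAt_add_smul {E : Type*} [NormedAddCommGroup E] [NormedSpace ℝ E] (p v : E) :
    HasDerivAt (fun t : ℝ => p + t • v) v 0 := by
  simpa using ((hasDerivAt_id (0 : ℝ)).smul_const v).const_add p

theorem hasDerivAt_comp_line {E F : Type*} [NormedAddCommGroup E] [NormedSpace ℝ E]
    [NormedAddCommGroup F] [NormedSpace ℝ F] {f : E → F} {p : E} (hf : ContDiffAt ℝ ∞ f p)
    (v : E) : HasDerivAt (fun t : ℝ => f (p + t • v)) (fderiv ℝ f p v) 0 := by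
  have h2 : HasFDerivAt f (fderiv ℝ f p) (p + (0 : ℝ) • v) := by
    simpa using (hf.differentiableAt (by simp)).hasFDerivAt
  exact h2.comp_hasDerivAt (0 : ℝ) (hasDerivAt_add_smul p v)

namespace RotationData

variable {k d : ℕ} (D : RotationData d)

/-- Translating the torus coordinates adds `∑ w_l dT_l / (2π)` to the pull-back of `β_k`, and
rotating by a variable angle `s` subtracts `|q|² ds / 2`. With `w = |q|² σ` and `κ = |σ|²` these
agree exactly when `m' + h/2 + κ h' = 0`. The weights `1/(2π)` and `1/2` account for the factors
`π²` and `π` in the translation and the angle. -/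
theorem exists_hasDerivAt_shift_angle (t : ℝ) {p : Ambient k d} (hz : p.2.1 ≠ 0)
    (v : Ambient k d) : ∃ (T' : Fin k → ℝ) (s' : ℝ),
      (∀ l, HasDerivAt (fun τ : ℝ => D.shift t (p + τ • v) l) (T' l) 0) ∧
      HasDerivAt (fun τ : ℝ => D.angle t (p + τ • v)) s' 0 ∧
      ∑ l, p.2.2 l / (2 * Real.pi) * T' l =
        1 / 2 * (‖negPairing D.a D.b D.j p.2.1‖ ^ 2 * s') := by
  set σ' : Fin k → ℝ := fderiv ℝ D.slope p v
  have hσ (l) : HasDerivAt (fun τ : ℝ => D.slope (p + τ • v) l) (σ' l) 0 :=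
    hasDerivAt_pi.1 (hasDerivAt_comp_line (D.contDiffAt_slope hz) v) l
  set κ' : ℝ := ∑ l, 2 * D.slope p l * σ' l with hκ'
  have hκ : HasDerivAt (fun τ : ℝ => D.slopeSq (p + τ • v)) κ' 0 := by
    refine HasDerivAt.fun_sum fun l _ => ?_
    convert! (hσ l).pow 2 using 1
    simp
  set κ := D.slopeSq p with hκ0
  have hcomp {f : ℝ → ℝ} (hf : ContDiff ℝ ∞ f) :
      HasDerivAt (fun τ : ℝ => f (D.slopeSq (p + τ • v))) (deriv f κ * κ') 0 := by
    have h1 : HasDerivAt f (deriv f κ) (D.slopeSq (p + (0 : ℝ) • v)) := by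
      rw [zero_smul, add_zero]
      exact (hf.differentiable (by simp) κ).hasDerivAt
    exact h1.comp (0 : ℝ) hκ
  refine ⟨fun l => -(Real.pi ^ 2 * t * (deriv D.h κ * κ')) * D.slope p l +
    -(Real.pi ^ 2 * t * D.h κ) * σ' l, Real.pi * t * (deriv D.m κ * κ'), fun l => ?_, ?_, ?_⟩
  · have h1 := (((hcomp D.contDiff_h).const_mul (Real.pi ^ 2 * t)).neg).fun_mul (hσ l)
    simpa [shift, ← hκ0] using h1
  · exact (hcomp D.contDiff_m).const_mul _
  · have hκs : κ = ∑ l, D.slope p l ^ 2 := rfl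
    clear_value κ' κ
    set N := ‖negPairing D.a D.b D.j p.2.1‖ ^ 2 with hN
    have hN0 : N ≠ 0 := by
      simpa [hN] using negPairing_ne_zero (j := D.j) D.sq_eq hz
    have hw (l) : p.2.2 l = N * D.slope p l := by
      simp [slope, ← hN, hN0]
    have h1 : ∑ l, p.2.2 l / (2 * Real.pi) * (-(Real.pi ^ 2 * t * (deriv D.h κ * κ')) *
        D.slope p l + -(Real.pi ^ 2 * t * D.h κ) * σ' l) =
        -(N * Real.pi * t / 2 * deriv D.h κ * κ') * κ - N * Real.pi * t / 4 * D.h κ * κ' := by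
      generalize D.h κ = H, deriv D.h κ = H'
      have h2 : -(N * Real.pi * t / 2 * H' * κ') * κ - N * Real.pi * t / 4 * H * κ' =
          -(N * Real.pi * t / 2 * H' * κ') * (∑ l, D.slope p l ^ 2) -
            N * Real.pi * t / 4 * H * ∑ l, 2 * D.slope p l * σ' l := by
        rw [← hκs, ← hκ']
      rw [h2, Finset.mul_sum, Finset.mul_sum, ← Finset.sum_sub_distrib]
      refine Finset.sum_congr rfl fun l _ => ?_
      rw [hw]
      field_simp
      ring
    rw [h1]
    linear_combination -(N * Real.pi * t / 2 * κ') * D.deriv_eq κ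

/-- The homogeneous flow preserves `β_k`, and the projection to the sphere rescales it by the square
of the dilation factor, since both `w` and quadratic expressions in `z` have weight two. -/
theorem betaForm_fderiv_contactFlow (t : ℝ) {p : Ambient k d} (hp : p.1 ∈ torus (Fin k))
    (hz : p.2.1 ≠ 0) (v : Ambient k d) :
    betaForm k d (D.contactFlow t p) (fderiv ℝ (D.contactFlow t) p v) =
      sphereScale (D.flow t p) ^ 2 * betaForm k d p v := by
  obtain ⟨T', s', hT, hs, hTs⟩ := D.exists_hasDerivAt_shift_angle t hz v
  have hflow : ContDiffAt ℝ ∞ (D.flow t) p :=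
    ContDiffAt.comp p (g := fun x : ℝ × Ambient k d => D.flow x.1 x.2) (f := fun p => (t, p))
      (D.contDiffAt_flow hz) (contDiffAt_const.prodMk contDiffAt_id)
  have hcf : ContDiffAt ℝ ∞ (D.contactFlow t) p :=
    ContDiffAt.comp p (g := fun x : ℝ × Ambient k d => D.contactFlow x.1 x.2)
      (f := fun p => (t, p)) (D.contDiffAt_contactFlow hz) (contDiffAt_const.prodMk contDiffAt_id)
  have hF := hasDerivAt_comp_line hcf v
  set F' := fderiv ℝ (D.contactFlow t) p v
  have hγ0 : p + (0 : ℝ) • v = p := by simp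
  set e : ℂ := Complex.exp (D.angle t p * Complex.I) with he_def
  have he : ‖e‖ = 1 := Complex.norm_exp_ofReal_mul_I _
  set Z := reflectSnd D.a D.b D.j e p.2.1 with hZ_def
  have hZ0 : Z ≠ 0 := reflectSnd_ne_zero D.sq_eq he hz
  have hne : (D.flow t p).2 ≠ 0 := D.flow_snd_ne_zero fun h => hz (by rw [h]; rfl)
  set q := negPairing D.a D.b D.j p.2.1 with hq_def
  -- derivatives along the line
  have hexp {f : ℝ → ℝ} {f' : ℝ} (hf : HasDerivAt f f' 0) :
      HasDerivAt (fun τ => Complex.exp (f τ * Complex.I))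
        (Complex.I * f' * Complex.exp (f 0 * Complex.I)) 0 := by
    have := (hf.ofReal_comp.mul_const Complex.I).cexp
    convert! this using 1
    ring
  set r' : ℝ := fderiv ℝ (fun p : Ambient k d => euclNorm p.2.1) p v
  have hr : HasDerivAt (fun τ : ℝ => euclNorm (p + τ • v).2.1) r' 0 :=
    hasDerivAt_comp_line (f := fun p : Ambient k d => euclNorm p.2.1)
      (ContDiffAt.comp p (g := euclNorm) (f := fun p : Ambient k d => p.2.1)
        (contDiffAt_euclNorm hz)
        (show ContDiff ℝ ∞ fun p : Ambient k d => p.2.1 by fun_prop).contDiffAt) v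
  have hzi (i : Fin d) : HasDerivAt (fun τ : ℝ => (p + τ • v).2.1 i) (v.2.1 i) 0 :=
    hasDerivAt_add_smul (p.2.1 i) (v.2.1 i)
  have hui (l : Fin k) : HasDerivAt (fun τ : ℝ => (p + τ • v).1 l) (v.1 l) 0 :=
    hasDerivAt_add_smul (p.1 l) (v.1 l)
  set q' : ℂ := D.a * r' - D.b * v.2.1 D.j with hq'_def
  have hq : HasDerivAt (fun τ : ℝ => negPairing D.a D.b D.j (p + τ • v).2.1) q' 0 :=
    (hr.ofReal_comp.const_mul _).sub ((hzi D.j).const_mul _)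
  have he' : HasDerivAt (fun τ : ℝ => Complex.exp (D.angle t (p + τ • v) * Complex.I))
      (Complex.I * s' * e) 0 := by
    have := hexp hs
    simp only [hγ0] at this
    exact this
  have hδ : HasDerivAt (fun τ : ℝ => (Complex.exp (D.angle t (p + τ • v) * Complex.I) - 1) *
      negPairing D.a D.b D.j (p + τ • v).2.1) (Complex.I * s' * e * q + (e - 1) * q') 0 := by
    have := (he'.sub_const 1).fun_mul hq
    simp only [hγ0] at this
    exact this
  set δ' : ℂ := Complex.I * s' * e * q + (e - 1) * q' with hδ'
  set y' : Fin d → ℂ := v.2.1 + Pi.single D.j (δ' * D.b) with hy'_def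
  set Z' : ℂ := r' + δ' * D.a with hZ'_def
  have hZ : HasDerivAt (fun τ : ℝ => reflectSnd D.a D.b D.j
      (Complex.exp (D.angle t (p + τ • v) * Complex.I)) (p + τ • v).2.1) Z' 0 :=
    hr.ofReal_comp.add (hδ.mul_const _)
  have hZc : HasDerivAt (fun τ : ℝ => conj (reflectSnd D.a D.b D.j
      (Complex.exp (D.angle t (p + τ • v) * Complex.I)) (p + τ • v).2.1)) (conj Z') 0 :=
    Complex.conjCLE.toContinuousLinearMap.hasFDerivAt.comp_hasDerivAt (0 : ℝ) hZ
  have hy (i : Fin d) : HasDerivAt (fun τ : ℝ => reflectFst D.a D.b D.j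
      (Complex.exp (D.angle t (p + τ • v) * Complex.I)) (p + τ • v).2.1 i) (y' i) 0 := by
    by_cases hi : i = D.j
    · subst hi
      simp only [reflectFst, Pi.add_apply, Pi.single_eq_same, hy'_def]
      exact (hzi D.j).add (hδ.mul_const _)
    · simp only [reflectFst, Pi.add_apply, hy'_def, Pi.single_eq_of_ne hi, add_zero]
      exact hzi i
  -- Only the existence and reality of this derivative matter: varying a real factor is a radial
  -- motion, which the angular form does not see.
  obtain ⟨μ', hμ⟩ : ∃ μ' : ℝ, HasDerivAt (fun τ : ℝ => sphereScale (D.flow t (p + τ • v)) *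
      ‖reflectSnd D.a D.b D.j (Complex.exp (D.angle t (p + τ • v) * Complex.I))
        (p + τ • v).2.1‖⁻¹) μ' 0 := by
    have h1 := hasDerivAt_comp_line (f := fun p => sphereScale (D.flow t p))
      (ContDiffAt.comp p (g := sphereScale) (f := D.flow t) (contDiffAt_sphereScale hne) hflow) v
    have h2 := hZ.differentiableAt.norm ℝ (by simpa only [hγ0] using hZ0)
    have h3 := h2.fun_inv (by simpa only [hγ0] using norm_ne_zero_iff.2 hZ0)
    exact ⟨_, (h1.differentiableAt.fun_mul h3).hasDerivAt⟩
  set μ : ℝ := sphereScale (D.flow t p) * ‖Z‖⁻¹ with hμ_def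
  -- the components of the derivative
  have hF1 (l : Fin k) : F'.1 l = v.1 l * Complex.exp (D.shift t p l * Complex.I) +
      p.1 l * (Complex.I * T' l * Complex.exp (D.shift t p l * Complex.I)) := by
    have h1 : HasDerivAt (fun τ : ℝ => (D.contactFlow t (p + τ • v)).1 l) (F'.1 l) 0 :=
      hasDerivAt_pi.1 hF.fst l
    have h2 := (hui l).fun_mul (hexp (hT l))
    simp only [hγ0] at h2
    exact h1.unique h2
  have hF2 (i : Fin d) : F'.2.1 i = (μ' * conj Z + μ * conj Z') *
      reflectFst D.a D.b D.j e p.2.1 i + μ * conj Z * y' i := by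
    have h1 : HasDerivAt (fun τ : ℝ => (D.contactFlow t (p + τ • v)).2.1 i) (F'.2.1 i) 0 :=
      hasDerivAt_pi.1 hF.snd.fst i
    have h2 := (hμ.ofReal_comp.fun_mul hZc).fun_mul (hy i)
    simp only [hγ0] at h2
    refine h1.unique ?_
    convert! h2 using 1
    funext τ
    simp [contactFlow, normalize, dilate, flow, reflect, reflectPhase]
    ring
  have hval1 (l : Fin k) : (D.contactFlow t p).1 l =
      p.1 l * Complex.exp (D.shift t p l * Complex.I) := rfl
  have hval2 (i : Fin d) : (D.contactFlow t p).2.1 i =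
      μ * conj Z * reflectFst D.a D.b D.j e p.2.1 i := by
    simp [contactFlow, normalize, dilate, flow, reflect, reflectPhase, hμ_def, hZ_def, he_def]
    ring
  have hval3 (l : Fin k) : (D.contactFlow t p).2.2 l = sphereScale (D.flow t p) ^ 2 * p.2.2 l :=
    rfl
  have hμZ : μ ^ 2 * ‖Z‖ ^ 2 = sphereScale (D.flow t p) ^ 2 := by
    have : ‖Z‖ ≠ 0 := norm_ne_zero_iff.2 hZ0
    rw [hμ_def]
    field_simp
  have hsum1 : ∑ l, (D.contactFlow t p).2.2 l / (2 * Real.pi) *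
      angularForm ((D.contactFlow t p).1 l) (F'.1 l) =
      sphereScale (D.flow t p) ^ 2 * (∑ l, p.2.2 l / (2 * Real.pi) * angularForm (p.1 l) (v.1 l) +
        ∑ l, p.2.2 l / (2 * Real.pi) * T' l) := by
    rw [← Finset.sum_add_distrib, Finset.mul_sum]
    refine Finset.sum_congr rfl fun l _ => ?_
    have h1 : angularForm ((D.contactFlow t p).1 l) (F'.1 l) =
        angularForm (p.1 l) (v.1 l) + T' l := by
      have h2 := angularForm_mul_deriv (p.1 l) (v.1 l)
        (Complex.exp (D.shift t p l * Complex.I))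
        (Complex.I * T' l * Complex.exp (D.shift t p l * Complex.I))
      rw [hval1, hF1, h2, hp l, Complex.norm_exp_ofReal_mul_I, angularForm_eq_im,
        show ∀ x : ℂ, conj x * (Complex.I * T' l * x) = T' l * (conj x * x) * Complex.I from
          fun x => by ring,
        conj_mul_self_of_norm_eq_one (Complex.norm_exp_ofReal_mul_I _)]
      simp
      ring
    rw [h1, hval3]
    ring
  have hsum2 : ∑ i, 1 / 2 * angularForm ((D.contactFlow t p).2.1 i) (F'.2.1 i) =
      sphereScale (D.flow t p) ^ 2 * (∑ i, 1 / 2 * angularForm (p.2.1 i) (v.2.1 i) -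
        1 / 2 * (‖q‖ ^ 2 * s')) := by
    have h1 (i : Fin d) : angularForm ((D.contactFlow t p).2.1 i) (F'.2.1 i) =
        sphereScale (D.flow t p) ^ 2 *
          angularForm (reflectFst D.a D.b D.j e p.2.1 i) (y' i) -
        ‖reflectFst D.a D.b D.j e p.2.1 i‖ ^ 2 * (μ ^ 2 * angularForm Z Z') := by
      rw [hval2, hF2, angularForm_mul_deriv, angularForm_conj_deriv, norm_mul, RCLike.norm_conj,
        Complex.norm_real, mul_pow, Real.norm_eq_abs, sq_abs, hμZ]
      ring
    have h2 := sum_angularForm_reflect (j := D.j) D.sq_eq he p.2.1 v.2.1 r' s' hq'_def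
    simp only [← hq_def, ← hδ', ← hy'_def, ← hZ'_def, ← hZ_def] at h2
    simp only [h1]
    rw [← Finset.mul_sum, ← Finset.mul_sum, Finset.sum_sub_distrib, ← Finset.mul_sum,
      ← Finset.sum_mul, sum_norm_sq_reflectFst D.sq_eq he, ← hZ_def]
    -- The phase that makes the last coordinate positive contributes `-‖y‖² μ² angularForm Z Z'`,
    -- where `y` is the reflected first component. As `‖y‖ = ‖Z‖` on the null cone and `μ²‖Z‖²` is
    -- the square of the scale, this is the negative term of the form of signature `(d,1)`.
    linear_combination sphereScale (D.flow t p) ^ 2 / 2 * h2 - angularForm Z Z' / 2 * hμZ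
  rw [betaForm_apply, betaForm_apply, hsum1, hsum2, hTs]
  ring

theorem isContactomorphism_contactFlow (t : ℝ) :
    IsContactomorphism (torusSphere k d) (betaForm k d) (D.contactFlow t) := by
  refine ⟨D.isDiffeo_contactFlow t, fun p hp v hv => ?_⟩
  by_cases hz : p.2.1 = 0
  · have h1 : HasFDerivWithinAt (D.contactFlow t) (ContinuousLinearMap.id ℝ (Ambient k d))
        (torusSphere k d) p := by
      refine (hasFDerivWithinAt_id p _).congr_of_eventuallyEq ?_
        (D.contactFlow_eq_self hp (Or.inl hz))
      rw [Filter.EventuallyEq, eventually_nhdsWithin_iff]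
      filter_upwards [D.eventually_contactFlow_eq_self hp hz] with q hq hqV using hq hqV t
    rw [fderivWithin_of_mem_tangentSpace h1 hv, D.contactFlow_eq_self hp (Or.inl hz)]
    rfl
  · have hcf : ContDiffAt ℝ ∞ (D.contactFlow t) p :=
      ContDiffAt.comp p (g := fun x : ℝ × Ambient k d => D.contactFlow x.1 x.2)
        (f := fun p => (t, p)) (D.contDiffAt_contactFlow hz)
        (contDiffAt_const.prodMk contDiffAt_id)
    have h1 := (hcf.differentiableAt (by simp)).hasFDerivAt.hasFDerivWithinAt (s := torusSphere k d)
    have h2 := sphereScale_pos (D.flow_snd_ne_zero (t := t) (snd_ne_zero_of_mem_torusSphere hp))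
    rw [fderivWithin_of_mem_tangentSpace h1 hv, D.betaForm_fderiv_contactFlow t hp.1 hz v,
      mul_eq_zero, or_iff_right (pow_pos h2 2).ne']

theorem isContactIsotopy_contactFlow :
    IsContactIsotopy (torusSphere k d) (betaForm k d) D.contactFlow :=
  ⟨D.contDiffOn_contactFlow _, fun _ hp => D.contactFlow_zero hp,
    fun t _ => D.isContactomorphism_contactFlow t⟩

end RotationData

/-! ### Choice of the rotation, and displacement of the fibers. -/

/-- For the homogeneous Hamiltonian `F = H χ(κ)`, `κ = |w|²/H²`, the partial derivatives are `∂F/∂H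
= χ - 2κχ'` and `∂F/∂w = 2χ' w/H`. They give `m` and `h`, and the differential relation between the
two is automatic. -/
theorem exists_cutoff : ∃ h m : ℝ → ℝ, ContDiff ℝ ∞ h ∧ ContDiff ℝ ∞ m ∧
    (∀ x, deriv m x + h x / 2 + x * deriv h x = 0) ∧ (∀ x, 1 ≤ x → h x = 0) ∧
    (∀ x, 1 ≤ x → m x = 0) ∧ m 0 = 1 := by
  set χ : ℝ → ℝ := fun x => Real.smoothTransition (1 - x) with hχ
  have hχs : ContDiff ℝ ∞ χ := Real.smoothTransition.contDiff.comp (contDiff_const.sub contDiff_id)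
  have hχ's : ContDiff ℝ ∞ (deriv χ) := (contDiff_infty_iff_deriv.1 hχs).2
  have h0 (x : ℝ) (hx : 1 ≤ x) : χ x = 0 :=
    Real.smoothTransition.zero_of_nonpos (by linarith)
  -- At the endpoint `x = 1` too, because `χ ≥ 0` attains its minimum there.
  have h1 (x : ℝ) (hx : 1 ≤ x) : deriv χ x = 0 :=
    IsLocalMin.deriv_eq_zero (Filter.Eventually.of_forall fun y => by
      rw [h0 x hx]; exact Real.smoothTransition.nonneg _)
  refine ⟨fun x => 2 * deriv χ x, fun x => χ x - 2 * x * deriv χ x, contDiff_const.mul hχ's,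
    hχs.sub ((contDiff_const.mul contDiff_id).mul hχ's), fun x => ?_, fun x hx => ?_,
    fun x hx => ?_, ?_⟩
  · have h2 := (hχs.differentiable (by simp) x).hasDerivAt
    have h3 := (hχ's.differentiable (by simp) x).hasDerivAt
    rw [(h3.const_mul 2).deriv,
      (h2.fun_sub ((((hasDerivAt_id' x).const_mul 2)).fun_mul h3)).deriv]
    ring
  · simp [h1 x hx]
  · simp [h0 x hx, h1 x hx]
  · simp [hχ]

/-- The center of rotation is `√c e_j`: then `a²(1 - c) = 1`, and `b < a` turns this equality into
the required strict inequality. -/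
theorem exists_rotationData {d : ℕ} (j : Fin d) {c : ℝ} (hc0 : 0 < c) (hc1 : c < 1) :
    ∃ D : RotationData d, D.j = j ∧ 0 < D.a ∧ 0 ≤ D.b ∧ 1 < D.a ^ 2 - D.a * D.b * c := by
  obtain ⟨h, m, hh, hm, h1, h2, h3, h4⟩ := exists_cutoff
  have hc : 0 < 1 - c := by linarith
  have ha := Real.sq_sqrt (one_div_pos.2 hc).le
  have hb := Real.sq_sqrt (div_pos hc0 hc).le
  have ha0 := Real.sqrt_pos.2 (one_div_pos.2 hc)
  have hb0 := Real.sqrt_nonneg (c / (1 - c))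
  set a := √(1 / (1 - c))
  set b := √(c / (1 - c))
  have hab : a ^ 2 = 1 + b ^ 2 := by
    rw [ha, hb]
    field_simp
    ring
  refine ⟨⟨a, b, j, h, m, hab, hh, hm, h1, h2, h3, h4⟩, rfl, ha0, hb0, ?_⟩
  have hba : b < a := lt_of_pow_lt_pow_left₀ 2 ha0.le (by linarith)
  have h5 : a ^ 2 * (1 - c) = 1 := by
    rw [ha]
    field_simp
  have h6 : a * b * c < a * a * c :=
    mul_lt_mul_of_pos_right (mul_lt_mul_of_pos_left hba ha0) hc0
  change 1 < a ^ 2 - a * b * c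
  nlinarith

theorem isDisplaceable_toricFiber {k d : ℕ} (hd : 1 < d) {c : Fin d → ℝ} (hc : ∀ j, 0 < c j)
    (hc1 : ∑ j, c j ^ 2 = 1) :
    IsDisplaceable (torusSphere k d) (betaForm k d) (toricFiber k d c 0) := by
  set j : Fin d := ⟨0, by omega⟩
  set i : Fin d := ⟨1, hd⟩
  have hij : i ≠ j := by simp [i, j]
  have hcj : c j < 1 := by
    have h1 : c i ^ 2 + c j ^ 2 ≤ ∑ l, c l ^ 2 := by
      rw [← Finset.sum_pair (f := fun l => c l ^ 2) hij]
      exact Finset.sum_le_sum_of_subset_of_nonneg (Finset.subset_univ _) fun _ _ _ => sq_nonneg _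
    have h2 := pow_pos (hc i) 2
    nlinarith [hc j]
  obtain ⟨D, hDj, ha, hb, hD⟩ := exists_rotationData j (hc j) hcj
  refine ⟨D.contactFlow, D.isContactIsotopy_contactFlow, ?_⟩
  rw [Set.eq_empty_iff_forall_notMem]
  rintro _ ⟨⟨p, ⟨hp, hw, hz⟩, rfl⟩, ⟨hp', -, hz'⟩⟩
  have hκ : D.slopeSq p = 0 := by simp [RotationData.slopeSq, RotationData.slope, hw]
  -- On `w = 0` the slope vanishes and `m 0 = 1`, so the time-one angle is `π`.
  have he : Complex.exp (D.angle 1 p * Complex.I) = -1 := by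
    simp [RotationData.angle, hκ, D.m_zero]
  have hr : euclNorm p.2.1 = 1 := by simp [euclNorm, hz, hc1]
  have hz0 : p.2.1 ≠ 0 := fun h => by simp [h, euclNorm] at hr
  have hcf : (D.contactFlow 1 p).2.1 =
      sphereScale (D.flow 1 p) • reflect D.a D.b D.j (-1) p.2.1 := by
    rw [← he]
    rfl
  have hs : 0 < sphereScale (D.flow 1 p) :=
    sphereScale_pos (D.flow_snd_ne_zero (snd_ne_zero_of_mem_torusSphere hp))
  have hZ0 : reflectSnd D.a D.b D.j (-1) p.2.1 ≠ 0 := reflectSnd_ne_zero D.sq_eq (by simp) hz0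
  -- The coordinate `i ≠ j`, available since `d > 1`, changes only by a phase and the scale; its
  -- modulus is `c i` before and after, so the scale is one.
  have hscale : sphereScale (D.flow 1 p) = 1 := by
    have h1 := hz' i
    rw [hcf, Pi.smul_apply, norm_smul, Real.norm_of_nonneg hs.le, reflect, Pi.smul_apply, norm_smul,
      norm_reflectPhase hZ0, one_mul, reflectFst, Pi.add_apply,
      Pi.single_eq_of_ne (hDj ▸ hij), add_zero, hz i] at h1
    exact (mul_eq_right₀ (hc i).ne').1 h1
  have hZ1 : ‖reflectSnd D.a D.b D.j (-1) p.2.1‖ = 1 := by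
    have hcf' : (D.contactFlow 1 p).2.1 = reflect D.a D.b D.j (-1) p.2.1 := by
      rw [hcf, hscale, one_smul]
    rw [← euclNorm_reflect D.sq_eq (by simp) hz0, ← hcf', euclNorm]
    simp [hz', hc1]
  -- The contradiction: `Re z_j ≤ c_j` and the choice of `a`, `b` push this real part below `-1`,
  -- while the modulus is one.
  have hre : (reflectSnd D.a D.b D.j (-1) p.2.1).re =
      1 - 2 * (D.a ^ 2 - D.a * D.b * (p.2.1 j).re) := by
    simp [reflectSnd, negPairing, hr, hDj]
    ring
  have h1 := Complex.abs_re_le_norm (reflectSnd D.a D.b D.j (-1) p.2.1)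
  rw [hZ1, hre, abs_le] at h1
  have h2 : (p.2.1 j).re ≤ c j := hz j ▸ Complex.re_le_norm _
  have h3 := mul_le_mul_of_nonneg_left h2 (mul_nonneg ha.le hb)
  linarith [h1.1]

theorem isDisplaceable_stdFiber {d : ℕ} (hd : 1 < d) {c : Fin d → ℝ} (hc : ∀ j, 0 < c j)
    (hc1 : ∑ j, c j ^ 2 = 1) : IsDisplaceable (stdSphere d) (stdForm d) (stdFiber d c) := by
  rw [← image_torusSphere_zero, ← image_toricFiber_zero]
  exact (isDisplaceable_toricFiber hd hc hc1).image (stdForm_ambientZeroEquiv d)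

end ToricContact

theorem mainTheorem5 (k d : ℕ) (hd : 1 < d) :
    -- `T^k × S^{2d+k-1}` is a contact toric manifold, not of Reeb type if `k ≥ 1`
    IsToricContact (torusSphere k d) (betaForm k d) (toricAction k d) ∧
    (1 ≤ k → ¬ IsReebType (torusSphere k d) (betaForm k d) (toricAction k d)) ∧
    -- it contains displaceable pre-Lagrangian toric fibers
    (∃ L : Set (Ambient k d),
      IsPreLagrangianToricFiber (torusSphere k d) (betaForm k d) (toricAction k d) L ∧
      IsDisplaceable (torusSphere k d) (betaForm k d) L) ∧
    -- the standard toric contact sphere is its reduction by the first `k` circles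
    IsToricContact (stdSphere d) (stdForm d) (stdAction d) ∧
    IsContactReduction (torusSphere k d) (betaForm k d) (firstAction k d)
      (stdSphere d) (stdForm d) (reductionMap k d) ∧
    (∀ (s : Fin k ⊕ Fin d → ℂ) (p : Ambient k d),
      reductionMap k d (toricAction k d s p) =
        stdAction d (fun j => s (Sum.inr j)) (reductionMap k d p)) ∧
    -- each fiber `|z_j| = c_j`, `w = 0` is the lift of a displaceable fiber of the sphere, and
    -- is itself displaceable
    ∀ c : Fin d → ℝ, (∀ j, 0 < c j) → ∑ j, c j ^ 2 = 1 →
      IsPreLagrangianToricFiber (stdSphere d) (stdForm d) (stdAction d) (stdFiber d c) ∧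
      IsDisplaceable (stdSphere d) (stdForm d) (stdFiber d c) ∧
      toricFiber k d c 0 =
        zeroLevel (torusSphere k d) (betaForm k d) (firstAction k d) ∩
          reductionMap k d ⁻¹' stdFiber d c ∧
      toricFiber k d c 0 = {p ∈ torusSphere k d |
        momentMap (betaForm k d) (toricAction k d) p =
          Sum.elim (fun _ => 0) (fun j => Real.pi * c j ^ 2)} ∧
      IsPreLagrangianToricFiber (torusSphere k d) (betaForm k d) (toricAction k d)
        (toricFiber k d c 0) ∧
      IsDisplaceable (torusSphere k d) (betaForm k d) (toricFiber k d c 0) := by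
  have hd0 : 0 < d := by omega
  refine ⟨isToricContact_torusSphere hd0, not_isReebType, ?_, isToricContact_stdSphere hd0,
    isContactReduction_torusSphere k d, fun s p => rfl, fun c hc hc1 =>
      ⟨isPreLagrangianToricFiber_stdFiber hd0 hc hc1, isDisplaceable_stdFiber hd hc hc1,
        toricFiber_eq_zeroLevel_inter k d c, toricFiber_eq_momentMap_fiber hc,
        isPreLagrangianToricFiber_toricFiber hd0 hc hc1, isDisplaceable_toricFiber hd hc hc1⟩⟩
  -- Existence is witnessed by the fiber with all radii equal.
  have hc (_ : Fin d) : 0 < (√d)⁻¹ := by positivity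
  have hc1 : ∑ _ : Fin d, (√d)⁻¹ ^ 2 = 1 := by
    simp [hd0.ne']
  exact ⟨_, isPreLagrangianToricFiber_toricFiber hd0 hc hc1, isDisplaceable_toricFiber hd hc hc1⟩
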